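/- Let $A$ be a finite set, $t\notin A$ a further letter, and let $w$ be a word over $(A\cup\{t\})^{\pm1}$ whose $t$-exponent sum is $0$; let $G=\langle A,t\mid w=1\rangle$ be the one-relator group it defines. Let $\overline w$ be the Magnus rewrite of $w$ with respect to $t$: the word over $\{a_i^{\pm1} : a\in A,\ i\in\mathbb Z\}$ obtained from $w$ by replacing each letter $a^{\varepsilon}$ ($a\in A$, $\varepsilon=\pm1$) by $a_i^{\varepsilon}$, where $i$ is the $t$-exponent sum of the prefix of $w$ that precedes this letter, and then deleting all letters $t^{\pm1}$. A letter $a_i$ is said to appear in $\overline w$ at each occurrence of $a_i$ or $a_i^{-1}$. (1) The assignment $t\mapsto t$, $a_i\mapsto t^i a t^{-i}$ defines an isomorphism $$\langle\, t,\ a_i\ (a\in A,\ i\in\mathbb Z)\ \mid\ \overline w=1,\quad t a_i t^{-1}=a_{i+1}\ (a\in A,\ i\in\mathbb Z)\,\rangle\ \cong\ G .$$ (2) Assume that for some letter $x\in A$ appearing in $w$, with $\max(x)$ and $\min(x)$ the greatest and the least $i$ such that $x_i$ appears in $\overline w$, each of the letters $x_{\max(x)}$ and $x_{\min(x)}$ appears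 exactly once in $\overline w$. Let $w_1,\dots,w_k$ ($k\ge 0$) be words over $(A\cup\{t\})^{\pm1}$, each of $t$-exponent sum $\ge 0$, and let $M\le G$ be the submonoid generated by the elements they represent. Then membership in $M$ is decidable: there is an algorithm that, given a word $\tau$ over $(A\cup\{t\})^{\pm1}$, decides whether $\tau$ represents an element of $M$. (3) This is uniform: there is a single algorithm that takes as input a finite alphabet $A=\{a_0,\dots,a_{n-1}\}$ (given by its size $n$), words $w,w_1,\dots,w_k$ satisfying all the conditions above, and a word $\tau$ over $(A\cup\{t\})^{\pm1}$, and decides whether $\tau$ represents an element of the submonoid $\langle w_1,\dots,w_k\rangle$ of $G=\langle A,t\mid w=1\rangle$. -/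

import Mathlib

namespace MagnusSubmonoid

/-- Group words over the alphabet `X`: the letter `(x, true)` is `x`, the letter `(x, false)` is
`x⁻¹` (the convention of `FreeGroup.mk`). Words need not be reduced. -/
abbrev Word (X : Type*) := List (X × Bool)

/-- The one-relator group `⟨X | r = 1⟩`. -/
abbrev OneRelatorGroup {X : Type*} (r : Word X) : Type _ :=
  PresentedGroup ({FreeGroup.mk r} : Set (FreeGroup X))

/-- The element of `⟨X | r = 1⟩` represented by the word `u`. -/
def val {X : Type*} (r u : Word X) : OneRelatorGroup r :=
  PresentedGroup.mk _ (FreeGroup.mk u)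

/-- The submonoid of `⟨X | r = 1⟩` generated by the elements that the words in `ws` represent. -/
def submonoidOf {X : Type*} (r : Word X) (ws : List (Word X)) :
    Submonoid (OneRelatorGroup r) :=
  Submonoid.closure {g | ∃ u ∈ ws, val r u = g}

/-! The generating set `A ∪ {t}` with `t ∉ A` is `Option A`: `none` is `t`, `some a` is `a`. -/

/-- The `t`-exponent sum `σ_t` of a word over `A ∪ {t}`. -/
def expSum {A : Type*} : Word (Option A) → ℤ
  | [] => 0
  | (none, true) :: l => expSum l + 1
  | (none, false) :: l => expSum l - 1
  | (some _, _) :: l => expSum l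

/-- Magnus rewriting of a word that is preceded by a prefix of `t`-exponent sum `i`. -/
def rewriteFrom {A : Type*} : ℤ → Word (Option A) → Word (A × ℤ)
  | _, [] => []
  | i, (none, true) :: l => rewriteFrom (i + 1) l
  | i, (none, false) :: l => rewriteFrom (i - 1) l
  | i, (some a, ε) :: l => ((a, i), ε) :: rewriteFrom i l

/-- The Magnus rewrite of `w` with respect to `t`: each letter `a^{±1}` with `a ∈ A` becomes
`a_i^{±1}`, where `i` is the `t`-exponent sum of the prefix of `w` before it, and all `t^{±1}` are
deleted. The letter `a_i` is the pair `(a, i)`. -/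
def rewrite {A : Type*} (w : Word (Option A)) : Word (A × ℤ) := rewriteFrom 0 w

/-- The number of occurrences of the letter `y`, with either sign, in a word. -/
def occ {Y : Type*} [DecidableEq Y] (y : Y) (u : Word Y) : ℕ := (u.map Prod.fst).count y

/-- For some letter `x ∈ A` that occurs in `w`, the letters `x_max` and `x_min` of extreme index
each occur exactly once in the Magnus rewrite of `w`. -/
def MaxMinCondition {A : Type*} [DecidableEq A] (w : Word (Option A)) : Prop :=
  ∃ (x : A) (M m : ℤ),
    IsGreatest {i : ℤ | 0 < occ (x, i) (rewrite w)} M ∧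
    IsLeast {i : ℤ | 0 < occ (x, i) (rewrite w)} m ∧
    occ (x, M) (rewrite w) = 1 ∧ occ (x, m) (rewrite w) = 1

/-- The relators of the infinite presentation on `t` (which is `none`) and the `a_i` (which are
`some (a, i)`): the Magnus rewrite of `w`, and `t a_i t⁻¹ a_{i+1}⁻¹` for `a ∈ A`, `i ∈ ℤ`. -/
def magnusRelators {A : Type*} (w : Word (Option A)) : Set (FreeGroup (Option (A × ℤ))) :=
  {FreeGroup.map some (FreeGroup.mk (rewrite w))} ∪
    {r | ∃ (a : A) (i : ℤ), r = FreeGroup.of none * FreeGroup.of (some (a, i)) *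
      (FreeGroup.of none)⁻¹ * (FreeGroup.of (some (a, i + 1)))⁻¹}

/-- Words over `{a_0, …, a_{n-1}, t}` as input data of an algorithm: `a_j` is coded by `j`. -/
def code {n : ℕ} (u : Word (Option (Fin n))) : Word (Option ℕ) :=
  u.map fun p => (p.1.map Fin.val, p.2)

end MagnusSubmonoid

namespace MagnusSubmonoid

open FreeGroup hiding map_mul map_inv map_one map.id map

/-! ### Magnus rewriting and the kernel of the map onto the base group. -/

section Rewriting

/-! Let `B` be the subgroup of `G` generated by the `a_i = t^i a t^{-i}`. Mapping `G` to a
semidirect product with `ℤ` shows that `B` is presented by the shifts `rewriteFrom k w` of the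
Magnus rewrite (`base_eq_one_iff`). So equality in `G` is equality of exponent sums together with
equality in `B` (`val_eq_val_iff`).

Under the max-min condition each shift of the relator can be solved for its highest or its lowest
`x`-letter. Hence `B` is free on the letters `a_i` with `a ≠ x` and the `x_i` with `m ≤ i < M`
(`IsPivot.mk_eq_mk_of_base_eq`, `IsPivot.exists_basic_word`).

The generators of the submonoid have exponent sum `≥ 0`, so in a product equal to `τ` the heights of
all prefixes lie between `0` and the exponent sum of `τ`. A factor `u` read at height `k`
contributes `rewriteFrom k u`. Membership thus asks whether an element of a free group is accepted
by a finite automaton, which Benois' saturation settles.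

The saturation is not carried out. Both the submonoid and its complement have checkable finite
certificates: a factorization (`mem_iff_exists_confirms`), or a saturated automaton without a
certain edge (`Refutes.not_mem`, `exists_refutes`). Equalities in `B` are certified by explicit
products of conjugates of relators. Searching for both kinds of certificate decides membership
(`computablePred_isValid_and_mem`). Uniformity follows by working over the alphabet `ℕ`, since
injective relabelling preserves membership. The presentation in (1) comes from two mutually inverse
homomorphisms. -/

theorem mk_cons_true {X : Type*} (x : X) (l : Word X) :
    (mk ((x, true) :: l) : FreeGroup X) = of x * mk l := by
  rw [of, mul_mk]; rfl

theorem mk_cons_false {X : Type*} (x : X) (l : Word X) :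
    (mk ((x, false) :: l) : FreeGroup X) = (of x)⁻¹ * mk l := by
  rw [of, inv_mk, mul_mk]; rfl

theorem mk_append {X : Type*} (u v : Word X) : (mk (u ++ v) : FreeGroup X) = mk u * mk v :=
  mul_mk.symm

theorem expSum_append {A : Type*} (u v : Word (Option A)) :
    expSum (u ++ v) = expSum u + expSum v := by
  induction u with
  | nil => simp [expSum]
  | cons p u ih =>
    obtain ⟨_ | a, _ | _⟩ := p <;> simp [expSum, ih] <;> ring

theorem rewriteFrom_append {A : Type*} (k : ℤ) (u v : Word (Option A)) :
    rewriteFrom k (u ++ v) = rewriteFrom k u ++ rewriteFrom (k + expSum u) v := by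
  induction u generalizing k with
  | nil => simp [expSum, rewriteFrom]
  | cons p u ih =>
    obtain ⟨_ | a, _ | _⟩ := p <;> simp [expSum, rewriteFrom, ih] <;> congr 1 <;> ring

theorem rewriteFrom_add {A : Type*} (i k : ℤ) (u : Word (Option A)) :
    rewriteFrom (i + k) u = (rewriteFrom i u).map fun p => ((p.1.1, p.1.2 + k), p.2) := by
  induction u generalizing i with
  | nil => simp [rewriteFrom]
  | cons p u ih =>
    obtain ⟨_ | a, _ | _⟩ := p <;> simp [rewriteFrom, ← ih] <;> congr 1 <;> ring

theorem rewriteFrom_eq_map {A : Type*} (k : ℤ) (u : Word (Option A)) :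
    rewriteFrom k u = (rewrite u).map fun p => ((p.1.1, p.1.2 + k), p.2) := by
  rw [rewrite, ← rewriteFrom_add, zero_add]

/-- The homomorphism `a_i ↦ t^i a t^{-i}`. -/
def unrewrite (A : Type*) : FreeGroup (A × ℤ) →* FreeGroup (Option A) :=
  lift fun p => of none ^ p.2 * of (some p.1) * (of none ^ p.2)⁻¹

/-- The conjugating powers of `t` telescope: between neighbouring letters they leave exactly the
deleted `t^{±1}`. -/
theorem unrewrite_rewriteFrom {A : Type*} (k : ℤ) (u : Word (Option A)) :
    unrewrite A (mk (rewriteFrom k u)) = of none ^ k * mk u * (of none ^ (k + expSum u))⁻¹ := by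
  induction u generalizing k with
  | nil => simp [expSum, rewriteFrom, ← one_eq_mk]
  | cons p u ih =>
    obtain ⟨_ | a, _ | _⟩ := p
    · rw [rewriteFrom, expSum, ih, mk_cons_false]
      have : k - 1 + expSum u = k + (expSum u - 1) := by ring
      rw [this]; group
    · rw [rewriteFrom, expSum, ih, mk_cons_true]
      have : k + 1 + expSum u = k + (expSum u + 1) := by ring
      rw [this]; group
    · rw [rewriteFrom, expSum, mk_cons_false, mk_cons_false, map_mul, ih, map_inv]
      simp [unrewrite, mul_assoc]
    · rw [rewriteFrom, expSum, mk_cons_true, mk_cons_true, map_mul, ih]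
      simp [unrewrite, mul_assoc]

/-- The normal closure of all shifts of the Magnus rewrite of `w`. -/
def rewriteClosure {A : Type*} (w : Word (Option A)) : Subgroup (FreeGroup (A × ℤ)) :=
  Subgroup.normalClosure (Set.range fun k => mk (rewriteFrom k w))

instance {A : Type*} (w : Word (Option A)) : (rewriteClosure w).Normal :=
  Subgroup.normalClosure_normal

/-- The action of `ℤ` on the free group on the letters `a_i` that shifts indices. -/
def shift (A : Type*) : Multiplicative ℤ →* MulAut (FreeGroup (A × ℤ)) where
  toFun k := freeGroupCongr ((Equiv.refl A).prodCongr (Equiv.addRight k.toAdd))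
  map_one' := by
    apply MulEquiv.toMonoidHom_injective
    ext ⟨a, i⟩
    simp
  map_mul' j k := by
    apply MulEquiv.toMonoidHom_injective
    ext ⟨a, i⟩
    simp [add_comm, add_left_comm]

theorem shift_mk {A : Type*} (k : Multiplicative ℤ) (v : Word (A × ℤ)) :
    shift A k (mk v) = mk (v.map fun p => ((p.1.1, p.1.2 + k.toAdd), p.2)) := by
  simp [shift]
  rfl

theorem shift_of {A : Type*} (k : Multiplicative ℤ) (a : A) (i : ℤ) :
    shift A k (of (a, i)) = of (a, i + k.toAdd) := by
  simp [shift]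

theorem shift_mem_rewriteClosure {A : Type*} {w : Word (Option A)} (k : Multiplicative ℤ)
    {f : FreeGroup (A × ℤ)} (hf : f ∈ rewriteClosure w) : shift A k f ∈ rewriteClosure w := by
  suffices rewriteClosure w ≤ (rewriteClosure w).comap (shift A k).toMonoidHom from this hf
  refine Subgroup.normalClosure_le_normal ?_
  rintro _ ⟨j, rfl⟩
  refine Subgroup.subset_normalClosure ⟨j + k.toAdd, ?_⟩
  simp [shift_mk, rewriteFrom_add]

/-- The elements of the semidirect product that lie in `rewriteClosure w`. -/
def semidirectKernel {A : Type*} (w : Word (Option A)) :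
    Subgroup (FreeGroup (A × ℤ) ⋊[shift A] Multiplicative ℤ) :=
  (rewriteClosure w).map SemidirectProduct.inl

theorem inl_mem_semidirectKernel {A : Type*} {w : Word (Option A)} {f : FreeGroup (A × ℤ)} :
    SemidirectProduct.inl f ∈ semidirectKernel w ↔ f ∈ rewriteClosure w := by
  constructor
  · rintro ⟨g, hg, h⟩
    rwa [← SemidirectProduct.inl_injective h]
  · exact fun h => ⟨f, h, rfl⟩

instance {A : Type*} (w : Word (Option A)) : (semidirectKernel w).Normal where
  conj_mem := by
    rintro _ ⟨f, hf, rfl⟩ g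
    have : g * SemidirectProduct.inl f * g⁻¹ =
        SemidirectProduct.inl (g.left * shift A g.right f * g.left⁻¹) := by
      ext <;> simp
    rw [this, inl_mem_semidirectKernel]
    exact Subgroup.Normal.conj_mem inferInstance _ (shift_mem_rewriteClosure _ hf) _

/-- The homomorphism `t ↦ t`, `a ↦ a_0` into the semidirect product. -/
def magnusHom (A : Type*) :
    FreeGroup (Option A) →* FreeGroup (A × ℤ) ⋊[shift A] Multiplicative ℤ :=
  lift fun o => o.elim (SemidirectProduct.inr (Multiplicative.ofAdd 1))
    fun a => SemidirectProduct.inl (of (a, 0))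

theorem magnusHom_unrewrite {A : Type*} (f : FreeGroup (A × ℤ)) :
    magnusHom A (unrewrite A f) = SemidirectProduct.inl f := by
  suffices (magnusHom A).comp (unrewrite A) = SemidirectProduct.inl from DFunLike.congr_fun this f
  refine FreeGroup.ext_hom _ _ fun ⟨a, i⟩ => ?_
  have h : (of (a, i) : FreeGroup (A × ℤ)) = shift A (Multiplicative.ofAdd i) (of (a, 0)) := by
    simp [shift_of]
  have h1 : (Multiplicative.ofAdd (1 : ℤ)) ^ i = Multiplicative.ofAdd i := by
    rw [← ofAdd_zsmul]; simp
  rw [h, SemidirectProduct.inl_aut]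
  simp only [MonoidHom.comp_apply, shift_of, unrewrite, magnusHom, lift_apply_of, map_mul, map_inv,
    map_zpow, toAdd_ofAdd, zero_add, Option.elim]
  rw [← map_zpow, h1]

theorem mk_eq_unrewrite {A : Type*} {w : Word (Option A)} (hw : expSum w = 0) (k : ℤ) :
    unrewrite A (mk (rewriteFrom k w)) = of none ^ k * mk w * (of none ^ k)⁻¹ := by
  rw [unrewrite_rewriteFrom, hw, add_zero]

/-- The homomorphism `a_i ↦ t^i a t^{-i}` into the one-relator group. -/
def base {A : Type*} (w : Word (Option A)) : FreeGroup (A × ℤ) →* OneRelatorGroup w :=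
  (PresentedGroup.mk _).comp (unrewrite A)

/-- `rewriteClosure w` is invariant under shifts, so it is normal in the whole semidirect product.
As `magnusHom` sends `w` into it, it sends the normal closure of `w` into it, and `magnusHom` undoes
`unrewrite`. -/
theorem base_eq_one_iff {A : Type*} {w : Word (Option A)} (hw : expSum w = 0)
    (f : FreeGroup (A × ℤ)) : base w f = 1 ↔ f ∈ rewriteClosure w := by
  constructor
  · intro h
    have h' : unrewrite A f ∈ Subgroup.normalClosure {mk w} := PresentedGroup.mk_eq_one_iff.1 h
    rw [← inl_mem_semidirectKernel, ← magnusHom_unrewrite]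
    suffices Subgroup.normalClosure {mk w} ≤ (semidirectKernel w).comap (magnusHom A) from this h'
    refine Subgroup.normalClosure_le_normal ?_
    rintro _ rfl
    have := mk_eq_unrewrite hw 0
    simp only [zpow_zero, one_mul, inv_one, mul_one] at this
    rw [SetLike.mem_coe, Subgroup.mem_comap, ← this, magnusHom_unrewrite, inl_mem_semidirectKernel]
    exact Subgroup.subset_normalClosure ⟨0, rfl⟩
  · suffices rewriteClosure w ≤ (base w).ker from fun h => this h
    refine Subgroup.normalClosure_le_normal ?_
    rintro _ ⟨k, rfl⟩
    change PresentedGroup.mk _ (unrewrite A _) = 1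
    rw [mk_eq_unrewrite hw, map_mul, map_mul, map_inv,
      PresentedGroup.one_of_mem (Set.mem_singleton (mk w))]
    simp

/-- The element `t` of the one-relator group. -/
def stable {A : Type*} (w : Word (Option A)) : OneRelatorGroup w := PresentedGroup.of none

theorem base_rewriteFrom {A : Type*} (w : Word (Option A)) (k : ℤ) (u : Word (Option A)) :
    base w (mk (rewriteFrom k u)) = stable w ^ k * val w u * (stable w ^ (k + expSum u))⁻¹ := by
  change PresentedGroup.mk _ (unrewrite A _) = _
  rw [unrewrite_rewriteFrom, map_mul, map_mul, map_inv, map_zpow, map_zpow]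
  rfl

theorem val_append {A : Type*} (w u v : Word A) : val w (u ++ v) = val w u * val w v := by
  rw [val, mk_append, map_mul]; rfl

theorem expSum_eq_of_val_eq {A : Type*} {w : Word (Option A)} (hw : expSum w = 0)
    {u v : Word (Option A)} (h : val w u = val w v) : expSum u = expSum v := by
  let f : Option A → Multiplicative ℤ := fun o => o.elim (Multiplicative.ofAdd 1) fun _ => 1
  have hf : ∀ u, lift f (mk u) = Multiplicative.ofAdd (expSum u) := by
    intro u
    induction u with
    | nil => simp [expSum]
    | cons p u ih =>
      obtain ⟨_ | a, _ | _⟩ := p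
      · rw [mk_cons_false, map_mul, ih, expSum, map_inv, lift_apply_of]
        simp [f, sub_eq_add_neg, mul_comm]
      · rw [mk_cons_true, map_mul, ih, expSum, lift_apply_of]
        simp [f, mul_comm]
      · rw [mk_cons_false, map_mul, ih, expSum, map_inv, lift_apply_of]
        simp [f]
      · rw [mk_cons_true, map_mul, ih, expSum, lift_apply_of]
        simp [f]
  have hr : ∀ r ∈ ({mk w} : Set (FreeGroup (Option A))), lift f r = 1 := by
    rintro _ rfl
    rw [hf, hw]; rfl
  have key : ∀ u, PresentedGroup.toGroup hr (val w u) = Multiplicative.ofAdd (expSum u) := hf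
  apply Multiplicative.ofAdd.injective
  rw [← key, ← key, h]

theorem val_eq_val_iff {A : Type*} {w : Word (Option A)} (hw : expSum w = 0)
    {u v : Word (Option A)} : val w u = val w v ↔
      expSum u = expSum v ∧ base w (mk (rewrite u)) = base w (mk (rewrite v)) := by
  simp only [rewrite, base_rewriteFrom]
  refine ⟨fun h => ?_, fun ⟨h, h'⟩ => ?_⟩
  · have := expSum_eq_of_val_eq hw h
    simp [h, this]
  · simpa [h] using h'

end Rewriting

/-! ### Solving equations for a letter that occurs once. -/

section Solving

theorem occ_pos_iff {Y : Type*} [DecidableEq Y] {y : Y} {u : Word Y} :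
    0 < occ y u ↔ ∃ b, (y, b) ∈ u := by
  rw [occ, List.count_pos_iff]
  simp

theorem occ_map {Y Z : Type*} [DecidableEq Y] [DecidableEq Z] {f : Y → Z}
    (hf : Function.Injective f) (y : Y) (u : Word Y) :
    occ (f y) (u.map fun p => (f p.1, p.2)) = occ y u := by
  rw [occ, occ, ← List.count_map_of_injective _ _ hf]
  simp [Function.comp_def]

theorem exists_split_of_occ_eq_one {Y : Type*} [DecidableEq Y] {z : Y} {r : Word Y}
    (h : occ z r = 1) :
    ∃ P b Q, r = P ++ (z, b) :: Q ∧ (∀ p ∈ P, p.1 ≠ z) ∧ ∀ p ∈ Q, p.1 ≠ z := by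
  have hz : z ∈ r.map Prod.fst := List.count_pos_iff.1 (by rw [occ] at h; omega)
  obtain ⟨⟨z', b⟩, hm, hzz⟩ := List.mem_map.1 hz
  obtain rfl : z' = z := hzz
  obtain ⟨P, Q, rfl⟩ := List.append_of_mem hm
  have h' : (P.map Prod.fst).count z' = 0 ∧ (Q.map Prod.fst).count z' = 0 := by
    simp only [occ, List.map_append, List.map_cons, List.count_append, List.count_cons_self] at h
    omega
  simp only [List.count_eq_zero, List.mem_map, not_exists, not_and] at h'
  exact ⟨P, b, Q, rfl, fun p hp => h'.1 p hp, fun p hp => h'.2 p hp⟩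

theorem lift_mk_congr {Y H : Type*} [Group H] {f g : Y → H} {r : Word Y}
    (h : ∀ p ∈ r, f p.1 = g p.1) : lift f (mk r) = lift g (mk r) := by
  rw [lift_mk, lift_mk]
  congr 1
  exact List.map_congr_left fun p hp => by rw [h p hp]

/-- In `P z^{±1} Q = 1` neither `P` nor `Q` involves `z`, so `z^{±1} = P⁻¹ Q⁻¹` is a solution. -/
theorem exists_update_lift_eq_one {Y H : Type*} [DecidableEq Y] [Group H] {z : Y} {r : Word Y}
    (hz : occ z r = 1) (f : Y → H) : ∃ h, lift (Function.update f z h) (mk r) = 1 := by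
  obtain ⟨P, b, Q, rfl, hP, hQ⟩ := exists_split_of_occ_eq_one hz
  let h₀ := (lift f (mk P))⁻¹ * (lift f (mk Q))⁻¹
  refine ⟨cond b h₀ h₀⁻¹, ?_⟩
  have e : ∀ h, ∀ l : Word Y, (∀ p ∈ l, p.1 ≠ z) →
      lift (Function.update f z h) (mk l) = lift f (mk l) := fun h l hl =>
    lift_mk_congr fun p hp => Function.update_of_ne (hl p hp) _ _
  cases b
  · rw [mk_append, mk_cons_false, map_mul, map_mul, e _ _ hP, e _ _ hQ, map_inv, lift_apply_of]
    simp [h₀]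
  · rw [mk_append, mk_cons_true, map_mul, map_mul, e _ _ hP, e _ _ hQ, lift_apply_of]
    simp [h₀]

theorem mem_of_lift_eq_one {Y H : Type*} [DecidableEq Y] [Group H] {z : Y} {r : Word Y}
    (hz : occ z r = 1) {f : Y → H} (hf : lift f (mk r) = 1) {S : Subgroup H}
    (hS : ∀ p ∈ r, p.1 ≠ z → f p.1 ∈ S) : f z ∈ S := by
  obtain ⟨P, b, Q, rfl, hP, hQ⟩ := exists_split_of_occ_eq_one hz
  have e : ∀ l : Word Y, (∀ p ∈ l, f p.1 ∈ S) → lift f (mk l) ∈ S := by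
    intro l hl
    rw [lift_mk]
    refine S.list_prod_mem fun x hx => ?_
    obtain ⟨⟨y, _ | _⟩, hp, rfl⟩ := List.mem_map.1 hx
    · exact S.inv_mem (hl _ hp)
    · exact hl _ hp
  have h1 := e P fun p hp => hS p (by simp [hp]) (hP p hp)
  have h2 := e Q fun p hp => hS p (by simp [hp]) (hQ p hp)
  cases b
  · rw [mk_append, mk_cons_false, map_mul, map_mul, map_inv, lift_apply_of] at hf
    have : f z = lift f (mk Q) * lift f (mk P) := by
      rw [← mul_assoc, mul_eq_one_iff_eq_inv, mul_inv_eq_iff_eq_mul] at hf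
      rw [hf]; simp
    exact this ▸ S.mul_mem h2 h1
  · rw [mk_append, mk_cons_true, map_mul, map_mul, lift_apply_of] at hf
    have : f z = (lift f (mk P))⁻¹ * (lift f (mk Q))⁻¹ := by
      rw [eq_inv_mul_iff_mul_eq, ← mul_eq_one_iff_eq_inv, mul_assoc, hf]
    exact this ▸ S.mul_mem (S.inv_mem h1) (S.inv_mem h2)

/-- The system is triangular: solving the `k`-th equation for `z k` leaves the earlier equations
intact, because they do not contain `z k`. -/
theorem exists_lift_eq_one_of_seq {Y H : Type*} [DecidableEq Y] [Group H] {z : ℕ → Y}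
    (hinj : Function.Injective z) {r : ℕ → Word Y} (hz : ∀ k, occ (z k) (r k) = 1)
    (hr : ∀ k, ∀ p ∈ r k, ∀ j, k < j → p.1 ≠ z j) (f : Y → H) :
    ∃ g : Y → H, (∀ y, (∀ k, y ≠ z k) → g y = f y) ∧ ∀ k, lift g (mk (r k)) = 1 := by
  choose s hs using fun k (f : Y → H) => exists_update_lift_eq_one (hz k) f
  let F : ℕ → Y → H := fun n => n.rec f fun k g => Function.update g (z k) (s k g)
  have hF : ∀ k, F (k + 1) = Function.update (F k) (z k) (s k (F k)) := fun k => rfl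
  have stab : ∀ n y, (∀ j, n ≤ j → y ≠ z j) → ∀ i, n ≤ i → F i y = F n y := by
    intro n y hy i hi
    induction i, hi using Nat.le_induction with
    | base => rfl
    | succ i hi ih => rw [hF, Function.update_of_ne (hy i hi), ih]
  -- Each letter is updated at most once, so its values stabilize and a limit assignment exists.
  have ex : ∀ y, ∃ n, ∀ i, n ≤ i → F i y = F n y := by
    intro y
    by_cases hy : ∃ k, y = z k
    · obtain ⟨k, rfl⟩ := hy
      exact ⟨k + 1, stab _ _ fun j hj h => by have := hinj h; omega⟩
    · exact ⟨0, stab _ _ fun j _ h => hy ⟨j, h⟩⟩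
  choose N hN using ex
  have lim : ∀ n y, (∀ j, n ≤ j → y ≠ z j) → F (N y) y = F n y := by
    intro n y hy
    rw [← stab n y hy (max n (N y)) (le_max_left _ _), hN y _ (le_max_right _ _)]
  refine ⟨fun y => F (N y) y, fun y hy => lim 0 y fun j _ => hy j, fun k => ?_⟩
  rw [← hs k (F k), ← hF]
  exact lift_mk_congr fun p hp => lim _ _ fun j hj => hr k p hp j hj

end Solving

/-! ### Freeness of the base group under the max-min condition. -/

section Pivot

/-- `x_M` and `x_m` occur exactly once in the Magnus rewrite of `w`, and `M` and `m` are the extreme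
indices with which `x` occurs. -/
def IsPivot {A : Type*} [DecidableEq A] (w : Word (Option A)) (x : A) (M m : ℤ) : Prop :=
  occ (x, M) (rewrite w) = 1 ∧ occ (x, m) (rewrite w) = 1 ∧
    ∀ p ∈ rewrite w, p.1.1 = x → m ≤ p.1.2 ∧ p.1.2 ≤ M

theorem maxMinCondition_iff {A : Type*} [DecidableEq A] (w : Word (Option A)) :
    MaxMinCondition w ↔ ∃ x M m, IsPivot w x M m := by
  constructor
  · rintro ⟨x, M, m, hM, hm, h1, h2⟩
    refine ⟨x, M, m, h1, h2, ?_⟩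
    rintro ⟨⟨_, i⟩, b⟩ hp rfl
    exact ⟨hm.2 (occ_pos_iff.2 ⟨b, hp⟩), hM.2 (occ_pos_iff.2 ⟨b, hp⟩)⟩
  · rintro ⟨x, M, m, h1, h2, h⟩
    refine ⟨x, M, m, ⟨by simp [h1], fun i hi => ?_⟩, ⟨by simp [h2], fun i hi => ?_⟩, h1, h2⟩
    · obtain ⟨b, hb⟩ := occ_pos_iff.1 hi
      exact (h _ hb rfl).2
    · obtain ⟨b, hb⟩ := occ_pos_iff.1 hi
      exact (h _ hb rfl).1

/-- The letters other than the `x_i` with `i < m` or `M ≤ i`. -/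
def IsBasic {A : Type*} (x : A) (M m : ℤ) (y : A × ℤ) : Prop := y.1 = x → m ≤ y.2 ∧ y.2 < M

theorem occ_rewriteFrom {A : Type*} [DecidableEq A] (w : Word (Option A)) (x : A) (i k : ℤ) :
    occ (x, i + k) (rewriteFrom k w) = occ (x, i) (rewrite w) := by
  have hinj : Function.Injective fun y : A × ℤ => (y.1, y.2 + k) := by
    rintro ⟨a, i⟩ ⟨b, j⟩ h
    simpa using h
  rw [rewriteFrom_eq_map]
  exact occ_map hinj (x, i) _

namespace IsPivot

variable {A : Type*} [DecidableEq A] {w : Word (Option A)} {x : A} {M m : ℤ}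

theorem occ_max (h : IsPivot w x M m) (k : ℤ) : occ (x, M + k) (rewriteFrom k w) = 1 := by
  rw [occ_rewriteFrom, h.1]

theorem occ_min (h : IsPivot w x M m) (k : ℤ) : occ (x, m + k) (rewriteFrom k w) = 1 := by
  rw [occ_rewriteFrom, h.2.1]

theorem bounds (h : IsPivot w x M m) (k : ℤ) (p : (A × ℤ) × Bool) (hp : p ∈ rewriteFrom k w)
    (hx : p.1.1 = x) : m + k ≤ p.1.2 ∧ p.1.2 ≤ M + k := by
  rw [rewriteFrom_eq_map, List.mem_map] at hp
  obtain ⟨q, hq, rfl⟩ := hp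
  have := h.2.2 q hq hx
  constructor <;> simp <;> omega

/-- The shifts `k ≥ 0` are solved upwards for `x_{M+k}`, the shifts `k < 0` downwards for `x_{m+k}`.
The basic letters are never touched. -/
theorem exists_retraction (h : IsPivot w x M m) :
    ∃ ρ : FreeGroup (A × ℤ) →* FreeGroup (A × ℤ),
      (∀ y, IsBasic x M m y → ρ (of y) = of y) ∧ rewriteClosure w ≤ ρ.ker := by
  obtain ⟨g, hg, hg'⟩ := exists_lift_eq_one_of_seq (z := fun k : ℕ => (x, M + k))
    (fun i j hij => by simpa using hij) (r := fun k => rewriteFrom k w)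
    (fun k => h.occ_max k)
    (fun k p hp j hj e => by
      have := h.bounds k p hp (by rw [e])
      rw [e] at this
      dsimp only at this
      omega) (of : A × ℤ → FreeGroup (A × ℤ))
  -- Shift `0` has been spent on `x_M`, so the downward round begins with shift `-1` and the letter
  -- `x_{m-1}`.
  obtain ⟨g₂, hg₂, hg₂'⟩ := exists_lift_eq_one_of_seq (z := fun k : ℕ => (x, m + (-1 - k)))
    (fun i j hij => by simpa using hij) (r := fun k => rewriteFrom (-1 - k) w)
    (fun k => h.occ_min (-1 - k))
    (fun k p hp j hj e => by
      have := h.bounds (-1 - k) p hp (by rw [e])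
      rw [e] at this
      dsimp only at this
      omega) g
  refine ⟨lift g₂, fun y hy => ?_, Subgroup.normalClosure_le_normal ?_⟩
  · rw [lift_apply_of, hg₂, hg]
    · rintro k rfl
      have := hy rfl
      dsimp only at this
      omega
    · rintro k rfl
      have := hy rfl
      dsimp only at this
      omega
  · rintro _ ⟨k, rfl⟩
    change lift g₂ _ = 1
    rcases lt_or_ge k 0 with hk | hk
    · obtain ⟨n, rfl⟩ : ∃ n : ℕ, k = -1 - n := ⟨(-1 - k).toNat, by omega⟩
      exact hg₂' n
    · obtain ⟨n, rfl⟩ := Int.eq_ofNat_of_zero_le hk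
      rw [← hg' n]
      -- A shift by `n ≥ 0` contains no `x_i` with `i < m`, so the second round has not disturbed
      -- its equation.
      refine lift_mk_congr fun p hp => hg₂ _ fun j e => ?_
      have := h.bounds n p hp (by rw [e])
      rw [e] at this
      dsimp only at this
      omega

/-- The retraction kills all relators and fixes basic words, so the basic letters satisfy no
relation in the base group. -/
theorem mk_eq_mk_of_base_eq (h : IsPivot w x M m) (hw : expSum w = 0) {u v : Word (A × ℤ)}
    (hu : ∀ p ∈ u, IsBasic x M m p.1) (hv : ∀ p ∈ v, IsBasic x M m p.1)
    (huv : base w (mk u) = base w (mk v)) : (mk u : FreeGroup (A × ℤ)) = mk v := by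
  obtain ⟨ρ, hρ, hk⟩ := h.exists_retraction
  have fix : ∀ u : Word (A × ℤ), (∀ p ∈ u, IsBasic x M m p.1) → ρ (mk u) = mk u := by
    intro u hu
    induction u with
    | nil => rw [← one_eq_mk, map_one]
    | cons p u ih =>
      have h1 := ih fun q hq => hu q (List.mem_cons_of_mem _ hq)
      have h2 := hρ p.1 (hu p List.mem_cons_self)
      obtain ⟨y, _ | _⟩ := p
      · rw [mk_cons_false, map_mul, map_inv, h1, h2]
      · rw [mk_cons_true, map_mul, h1, h2]
  have hm : (mk u)⁻¹ * mk v ∈ rewriteClosure w := by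
    rw [← base_eq_one_iff hw, map_mul, map_inv, huv, inv_mul_cancel]
  have := hk hm
  rwa [MonoidHom.mem_ker, map_mul, map_inv, fix u hu, fix v hv, inv_mul_eq_one] at this

/-- Shift `n ≥ 0` expresses `x_{M+n}` through lower `x`-letters of index at least `m` and letters
other than `x`. Once all `x_i` with `i ≥ m` are available, the negative shifts express the remaining
ones through higher letters. -/
theorem exists_basic_word (h : IsPivot w x M m) (hw : expSum w = 0) (f : FreeGroup (A × ℤ)) :
    ∃ v : Word (A × ℤ), (∀ p ∈ v, IsBasic x M m p.1) ∧ base w (mk v) = base w f := by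
  let ι : FreeGroup {y // IsBasic x M m y} →* FreeGroup (A × ℤ) := FreeGroup.map Subtype.val
  let S : Subgroup (OneRelatorGroup w) := ((base w).comp ι).range
  have hb : ∀ y, IsBasic x M m y → base w (of y) ∈ S := fun y hy => ⟨of ⟨y, hy⟩, by simp [ι]⟩
  have hrel : ∀ k, lift (fun y => base w (of y)) (mk (rewriteFrom k w)) = 1 := by
    intro k
    have : lift (fun y => base w (of y)) = base w := FreeGroup.ext_hom _ _ fun y => by simp
    rw [this, base_eq_one_iff hw]
    exact Subgroup.subset_normalClosure ⟨k, rfl⟩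
  have up : ∀ n : ℕ, ∀ i : ℤ, m ≤ i → i < M + n → base w (of (x, i)) ∈ S := by
    intro n
    induction n with
    | zero => exact fun i h1 h2 => hb _ fun _ => ⟨h1, by simpa using h2⟩
    | succ n ih =>
      intro i h1 h2
      rcases lt_or_ge i (M + n) with h3 | h3
      · exact ih i h1 h3
      · obtain rfl : i = M + n := by push_cast at h2; omega
        refine mem_of_lift_eq_one (h.occ_max n) (hrel n) fun p hp hne => ?_
        by_cases hx : p.1.1 = x
        · have := h.bounds n p hp hx
          have hne' : p.1.2 ≠ M + n := fun e => hne (Prod.ext hx e)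
          rw [show p.1 = (x, p.1.2) from Prod.ext hx rfl]
          exact ih _ (by omega) (by omega)
        · exact hb _ fun e => absurd e hx
  have down : ∀ n : ℕ, ∀ i : ℤ, m - n ≤ i → base w (of (x, i)) ∈ S := by
    intro n
    induction n with
    | zero => exact fun i h1 => up (i - M + 1).toNat i (by simpa using h1) (by omega)
    | succ n ih =>
      intro i h1
      rcases lt_or_ge i (m - n) with h3 | h3
      · obtain rfl : i = m + (-1 - n) := by push_cast at h1; omega
        refine mem_of_lift_eq_one (h.occ_min (-1 - n)) (hrel _) fun p hp hne => ?_
        by_cases hx : p.1.1 = x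
        · have := h.bounds _ p hp hx
          have hne' : p.1.2 ≠ m + (-1 - n) := fun e => hne (Prod.ext hx e)
          rw [show p.1 = (x, p.1.2) from Prod.ext hx rfl]
          exact ih _ (by omega)
        · exact hb _ fun e => absurd e hx
      · exact ih i h3
  have all : ∀ y, base w (of y) ∈ S := by
    rintro ⟨a, i⟩
    by_cases hx : a = x
    · subst hx
      exact down (m - i).toNat i (by omega)
    · exact hb _ fun e => absurd e hx
  have hf : base w f ∈ S := by
    have : (base w).range ≤ S := by
      have e : base w = lift (fun y => base w (of y)) := FreeGroup.ext_hom _ _ fun y => by simp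
      rw [e]
      exact range_lift_le (by rintro _ ⟨y, rfl⟩; exact all y)
    exact this ⟨f, rfl⟩
  obtain ⟨⟨l⟩, hl⟩ := hf
  have hl' : base w (mk (l.map fun p : {y // IsBasic x M m y} × Bool => (p.1.val, p.2))) =
      base w f := hl
  refine ⟨_, ?_, hl'⟩
  intro p hp
  obtain ⟨q, -, rfl⟩ := List.mem_map.1 hp
  exact q.1.2

end IsPivot

end Pivot

/-! ### Certificates for equality in the base group. -/

section Derivations

/-- A list of triples `(c, k, ε)`, standing for the product of the conjugates by `c` of the `ε`-th
powers of the `k`-th shift of the Magnus rewrite of the relator. -/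
abbrev Derivation (A : Type*) := List (Word (A × ℤ) × ℤ × Bool)

/-- The product of conjugates that a derivation stands for. -/
def conjProd {A : Type*} (w : Word (Option A)) (d : Derivation A) : Word (A × ℤ) :=
  d.flatMap fun c =>
    c.1 ++ (cond c.2.2 (rewriteFrom c.2.1 w) (invRev (rewriteFrom c.2.1 w)) ++ invRev c.1)

/-- One of the derivations in `D` shows that `u` and `v` are equal modulo `rewriteClosure w`. -/
def Derives {A : Type*} [DecidableEq A] (w : Word (Option A)) (D : List (Derivation A))
    (u v : Word (A × ℤ)) : Prop :=
  ∃ d ∈ D, reduce u = reduce (conjProd w d ++ v)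

theorem conjProd_mem {A : Type*} (w : Word (Option A)) (d : Derivation A) :
    mk (conjProd w d) ∈ rewriteClosure w := by
  induction d with
  | nil => exact (rewriteClosure w).one_mem
  | cons c d ih =>
    have hr : mk (rewriteFrom c.2.1 w) ∈ rewriteClosure w :=
      Subgroup.subset_normalClosure ⟨_, rfl⟩
    rw [conjProd, List.flatMap_cons, mk_append]
    refine Subgroup.mul_mem _ ?_ ih
    rw [mk_append, mk_append, ← inv_mk, ← mul_assoc]
    refine Subgroup.Normal.conj_mem inferInstance _ ?_ _
    cases c.2.2
    · rw [cond_false, ← inv_mk]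
      exact Subgroup.inv_mem _ hr
    · exact hr

theorem exists_conjProd_eq {A : Type*} {w : Word (Option A)} {f : FreeGroup (A × ℤ)}
    (hf : f ∈ rewriteClosure w) : ∃ d, mk (conjProd w d) = f := by
  rw [rewriteClosure, Subgroup.normalClosure, ← Subgroup.mem_toSubmonoid,
    Subgroup.closure_toSubmonoid] at hf
  obtain ⟨l, hl, rfl⟩ := Submonoid.exists_list_of_mem_closure hf
  clear hf
  induction l with
  | nil => exact ⟨[], rfl⟩
  | cons g l ih =>
    obtain ⟨d, hd⟩ := ih fun x hx => hl x (List.mem_cons_of_mem _ hx)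
    suffices ∃ c, mk (conjProd w [c]) = g by
      obtain ⟨c, rfl⟩ := this
      refine ⟨c :: d, ?_⟩
      rw [List.prod_cons, ← hd, ← mk_append]
      simp [conjProd]
    rcases hl g List.mem_cons_self with hg | hg
    · obtain ⟨_, ⟨k, rfl⟩, hc⟩ := Group.mem_conjugatesOfSet_iff.1 hg
      obtain ⟨c, rfl⟩ := isConj_iff.1 hc
      obtain ⟨c, rfl⟩ := Quot.exists_rep c
      refine ⟨(c, k, true), ?_⟩
      rw [conjProd, List.flatMap_singleton, mk_append, mk_append, ← inv_mk, ← mul_assoc]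
      rfl
    · obtain ⟨_, ⟨k, rfl⟩, hc⟩ := Group.mem_conjugatesOfSet_iff.1 hg
      obtain ⟨c, hc⟩ := isConj_iff.1 hc
      obtain ⟨c, rfl⟩ := Quot.exists_rep c
      change mk c * mk (rewriteFrom k w) * (mk c)⁻¹ = g⁻¹ at hc
      refine ⟨(c, k, false), ?_⟩
      rw [conjProd, List.flatMap_singleton, mk_append, mk_append, ← inv_mk, ← mul_assoc,
        cond_false, ← inv_mk, ← inv_inv g, ← hc]
      simp only [mul_inv_rev, inv_inv, mul_assoc]

theorem reduce_eq_reduce_iff {X : Type*} [DecidableEq X] {u v : Word X} :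
    reduce u = reduce v ↔ (mk u : FreeGroup X) = mk v :=
  ⟨reduce.exact, reduce.sound⟩

variable {A : Type*} [DecidableEq A] {w : Word (Option A)}

theorem Derives.base_eq (hw : expSum w = 0) {D : List (Derivation A)} {u v : Word (A × ℤ)}
    (h : Derives w D u v) : base w (mk u) = base w (mk v) := by
  obtain ⟨d, -, h⟩ := h
  rw [reduce_eq_reduce_iff] at h
  rw [h, mk_append, map_mul, (base_eq_one_iff hw _).2 (conjProd_mem w d), one_mul]

theorem Derives.mono {D D' : List (Derivation A)} (hD : D ⊆ D') {u v : Word (A × ℤ)}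
    (h : Derives w D u v) : Derives w D' u v := by
  obtain ⟨d, hd, h⟩ := h
  exact ⟨d, hD hd, h⟩

/-- One finite list can certify finitely many equalities at once, so a certificate needs only a
single list of derivations. -/
theorem exists_derives (hw : expSum w = 0) (P : List (Word (A × ℤ) × Word (A × ℤ)))
    (hP : ∀ p ∈ P, base w (mk p.1) = base w (mk p.2)) :
    ∃ D, ∀ p ∈ P, Derives w D p.1 p.2 := by
  induction P with
  | nil => exact ⟨[], by simp⟩
  | cons p P ih =>
    obtain ⟨D, hD⟩ := ih fun q hq => hP q (List.mem_cons_of_mem _ hq)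
    have h : mk p.1 * (mk p.2)⁻¹ ∈ rewriteClosure w := by
      rw [← base_eq_one_iff hw, map_mul, map_inv, hP p List.mem_cons_self, mul_inv_cancel]
    obtain ⟨d, hd⟩ := exists_conjProd_eq h
    refine ⟨d :: D, fun q hq => ?_⟩
    rcases List.mem_cons.1 hq with rfl | hq
    · refine ⟨d, List.mem_cons_self, ?_⟩
      rw [reduce_eq_reduce_iff, mk_append, hd, inv_mul_cancel_right]
    · exact (hD q hq).mono (List.subset_cons_self _ _)

end Derivations

/-! ### Elements of the submonoid as products of generating words. -/

section Membership

theorem mem_submonoidOf_iff {X : Type*} {r : Word X} {us : List (Word X)} {g : OneRelatorGroup r} :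
    g ∈ submonoidOf r us ↔ ∃ L : List (Word X), (∀ u ∈ L, u ∈ us) ∧ g = val r L.flatten := by
  constructor
  · intro h
    obtain ⟨l, hl, rfl⟩ := Submonoid.exists_list_of_mem_closure h
    clear h
    induction l with
    | nil => exact ⟨[], by simp, rfl⟩
    | cons g l ih =>
      obtain ⟨L, hL, e⟩ := ih fun x hx => hl x (List.mem_cons_of_mem _ hx)
      obtain ⟨u, hu, rfl⟩ := hl g List.mem_cons_self
      refine ⟨u :: L, by simpa [hu] using hL, ?_⟩
      rw [List.prod_cons, e, List.flatten_cons, val_append]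
  · rintro ⟨L, hL, rfl⟩
    induction L with
    | nil => exact (submonoidOf r us).one_mem
    | cons u L ih =>
      rw [List.flatten_cons, val_append]
      exact Submonoid.mul_mem _ (Submonoid.subset_closure ⟨u, hL u List.mem_cons_self, rfl⟩)
        (ih fun v hv => hL v (List.mem_cons_of_mem _ hv))

end Membership

/-! ### Saturated automata over a free group, after Benois. -/

section Automata

/-- The state `(u, k)` stands for the group element `u t^k`. -/
abbrev State (A : Type*) := Word (A × ℤ) × ℤ

/-- An edge of an automaton that is labelled by a word. -/
abbrev Edge (A : Type*) := State A × Word (A × ℤ) × State A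

/-- The existence of a path that reads a word letter by letter and ends with an edge labelled by the
empty word. -/
def Path {A : Type*} (T : List (Edge A)) : State A → Word (A × ℤ) → State A → Prop
  | p, [], q => (p, [], q) ∈ T
  | p, y :: v, q => ∃ r, (p, [y], r) ∈ T ∧ Path T r v q

/-- Each edge with a non-empty label starts with an edge that is labelled by the first letter. -/
def IsSplit {A : Type*} (T : List (Edge A)) : Prop :=
  ∀ e ∈ T, e.2.1 = [] ∨ ∃ e₁ ∈ T, ∃ e₂ ∈ T, e₁.1 = e.1 ∧ e₁.2.1 = e.2.1.take 1 ∧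
    e₁.2.2 = e₂.1 ∧ e₂.2.1 = e.2.1.tail ∧ e₂.2.2 = e.2.2

/-- Closure under composition and free reduction of edges with labels of length at most one. -/
def IsSaturated {A : Type*} [DecidableEq A] (T : List (Edge A)) : Prop :=
  ∀ e₁ ∈ T, ∀ e₂ ∈ T, e₁.2.2 = e₂.1 ∧ e₁.2.1.length ≤ 1 ∧ e₂.2.1.length ≤ 1 ∧
    (reduce (e₁.2.1 ++ e₂.2.1)).length ≤ 1 → (e₁.1, reduce (e₁.2.1 ++ e₂.2.1), e₂.2.2) ∈ T

variable {A : Type*} {T : List (Edge A)}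

theorem path_basic {x : A} {M m : ℤ} (hT : ∀ e ∈ T, ∀ p ∈ e.2.1, IsBasic x M m p.1)
    {p q : State A} {v : Word (A × ℤ)} (h : Path T p v q) : ∀ y ∈ v, IsBasic x M m y.1 := by
  induction v generalizing p with
  | nil => simp
  | cons y v ih =>
    obtain ⟨r, hr, hv⟩ := h
    intro z hz
    rcases List.mem_cons.1 hz with rfl | hz
    · exact hT _ hr z (by simp)
    · exact ih hv z hz

theorem IsSplit.path (hT : IsSplit T) {p q : State A} {v : Word (A × ℤ)} (h : (p, v, q) ∈ T) :
    Path T p v q := by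
  induction v generalizing p with
  | nil => exact h
  | cons y v ih =>
    rcases hT _ h with h | ⟨⟨p₁, l₁, r₁⟩, h₁, ⟨p₂, l₂, r₂⟩, h₂, e₁, e₂, e₃, e₄, e₅⟩
    · simp at h
    · simp only [List.take_succ_cons, List.take_zero, List.tail_cons] at e₁ e₂ e₃ e₄ e₅
      subst e₁ e₂ e₃ e₄ e₅
      exact ⟨_, h₁, ih h₂⟩

namespace IsSaturated

variable [DecidableEq A]

/-- Every edge used by a `Path` has a label of length at most one, so saturation absorbs the empty
edge into the next one. -/
theorem path_cons_nil (hT : IsSaturated T) {p q r : State A} {v : Word (A × ℤ)} (h : (p, [], q) ∈ T)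
    (hv : Path T q v r) : Path T p v r := by
  cases v with
  | nil => simpa [Path] using hT _ h _ hv (by simp)
  | cons y v =>
    obtain ⟨s, hs, hv⟩ := hv
    exact ⟨s, by simpa using hT _ h _ hs (by simp), hv⟩

theorem path_append (hT : IsSaturated T) {p q r : State A} {u v : Word (A × ℤ)} (hu : Path T p u q)
    (hv : Path T q v r) : Path T p (u ++ v) r := by
  induction u generalizing p with
  | nil => exact hT.path_cons_nil hu hv
  | cons y u ih =>
    obtain ⟨s, hs, hu⟩ := hu
    exact ⟨s, hs, ih hu⟩

/-- Two consecutive edges with inverse labels compose to an empty edge, which is then absorbed. -/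
theorem path_step (hT : IsSaturated T) {p q : State A} {u v : Word (A × ℤ)} (h : Red.Step u v) (hu : Path T p u q) :
    Path T p v q := by
  obtain @⟨l, l', y, b⟩ := h
  induction l generalizing p with
  | nil =>
    obtain ⟨r, hr, s, hs, hv⟩ := hu
    refine hT.path_cons_nil ?_ hv
    simpa [reduce.cons] using hT _ hr _ hs (by simp [reduce.cons])
  | cons z l ih =>
    obtain ⟨s, hs, hu⟩ := hu
    exact ⟨s, hs, ih hu⟩

theorem path_red (hT : IsSaturated T) {p q : State A} {u v : Word (A × ℤ)} (h : Red u v) (hu : Path T p u q) :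
    Path T p v q := by
  induction h with
  | refl => exact hu
  | tail _ h ih => exact hT.path_step h ih

theorem mem_of_path (hT : IsSaturated T) {p q : State A} {u : Word (A × ℤ)} (h : (mk u : FreeGroup (A × ℤ)) = 1)
    (hu : Path T p u q) : (p, [], q) ∈ T := by
  have : Red u [] := by
    have := reduce.red (L := u)
    rwa [show reduce u = [] by rw [← reduce_nil, reduce_eq_reduce_iff, h]; rfl] at this
  exact hT.path_red this hu

end IsSaturated

end Automata

/-! ### Certificates for membership and for non-membership. -/

section Refutation

variable {A : Type*} [DecidableEq A]

/-- A finite certificate for the fact that `τ` does not represent an element of the submonoid that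
the words in `ws` generate. -/
def Refutes (w : Word (Option A)) (ws : List (Word (Option A))) (τ : Word (Option A))
    (x : A) (M m : ℤ) (D : List (Derivation A)) (K : List ℤ) (T : List (Edge A)) : Prop :=
  IsPivot w x M m ∧ (∀ e ∈ T, ∀ p ∈ e.2.1, IsBasic x M m p.1) ∧ IsSplit T ∧ IsSaturated T ∧
    0 ∈ K ∧
    (∀ k ∈ K, ∀ u ∈ ws, k + expSum u ≤ expSum τ → k + expSum u ∈ K ∧
      ∃ e ∈ T, e.1 = ([], k) ∧ e.2.2 = ([], k + expSum u) ∧ Derives w D e.2.1 (rewriteFrom k u)) ∧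
    ∃ e ∈ T, e.2.2 = ([], 0) ∧ Derives w D (e.2.1 ++ rewrite τ) [] ∧
      (e.1, [], ([], expSum τ)) ∉ T

variable {w : Word (Option A)} {ws : List (Word (Option A))} {τ : Word (Option A)}
  {x : A} {M m : ℤ}

/-- A factorization of `τ` would trace a path whose label is trivial in the free group, and
saturation would shorten it to the excluded edge. -/
theorem Refutes.not_mem {D : List (Derivation A)} {K : List ℤ} {T : List (Edge A)}
    (h : Refutes w ws τ x M m D K T) (hw : expSum w = 0) (hws : ∀ u ∈ ws, 0 ≤ expSum u) :
    val w τ ∉ submonoidOf w ws := by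
  obtain ⟨hp, hb, hsp, hsat, h0, hK, ⟨q, v, _⟩, he, rfl, hv, hn⟩ := h
  intro hmem
  obtain ⟨L, hL, e⟩ := mem_submonoidOf_iff.1 hmem
  have nonneg : ∀ L : List (Word (Option A)), (∀ u ∈ L, u ∈ ws) → 0 ≤ expSum L.flatten := by
    intro L hL
    induction L with
    | nil => exact le_rfl
    | cons u L ih =>
      rw [List.flatten_cons, expSum_append]
      have := ih fun v hv => hL v (List.mem_cons_of_mem _ hv)
      have := hws u (hL u List.mem_cons_self)
      omega
  -- The factors still to be read have exponent sum `≥ 0`, so the bound on the final height bounds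
  -- every intermediate height and the edges provided by `hK` apply.
  have key : ∀ L : List (Word (Option A)), (∀ u ∈ L, u ∈ ws) → ∀ k ∈ K,
      k + expSum L.flatten ≤ expSum τ → ∀ u, Path T q u ([], k) →
      ∃ v, Path T q (u ++ v) ([], k + expSum L.flatten) ∧
        base w (mk v) = base w (mk (rewriteFrom k L.flatten)) := by
    intro L
    induction L with
    | nil => exact fun _ k _ _ u hu => ⟨[], by simpa [expSum] using hu, rfl⟩
    | cons a L ih =>
      intro hL k hk hle u hu
      have hL' : ∀ u ∈ L, u ∈ ws := fun v hv => hL v (List.mem_cons_of_mem _ hv)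
      have := nonneg L hL'
      rw [List.flatten_cons, expSum_append, ← add_assoc] at hle ⊢
      obtain ⟨hk', ⟨p, v, p'⟩, he, rfl, rfl, hd⟩ := hK k hk a (hL a List.mem_cons_self) (by omega)
      obtain ⟨v', hv', hb'⟩ := ih hL' _ hk' hle _ (hsat.path_append hu (hsp.path he))
      refine ⟨v ++ v', by rwa [← List.append_assoc], ?_⟩
      rw [rewriteFrom_append, mk_append, mk_append, map_mul, map_mul, hb', hd.base_eq hw]
  obtain ⟨eexp, ebase⟩ := (val_eq_val_iff hw).1 e
  obtain ⟨v', hpath, hb'⟩ := key L hL 0 h0 (by omega) v (hsp.path he)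
  refine hn ?_
  rw [zero_add, ← eexp] at hpath
  refine hsat.mem_of_path ?_ hpath
  -- In the base group `v` is the inverse of the rewrite of `τ`, and `v'` equals that rewrite. All
  -- labels are basic, so by freeness `v ++ v'` is already trivial in the free group.
  have hb1 : base w (mk (v ++ v')) = base w (mk []) := by
    rw [mk_append, map_mul, hb', ← hv.base_eq hw, mk_append, map_mul, ebase]
    rfl
  exact hp.mk_eq_mk_of_base_eq hw (path_basic hb hpath) (by simp) hb1

/-- Supplies both the labels and the first components of the states. Closure under tails and first
letters allows edges to be split within a finite set. -/
theorem exists_closed_words {Y : Type*} (P : Y → Prop) (Z : List (Word Y))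
    (hZ : ∀ z ∈ Z, ∀ p ∈ z, P p.1) :
    ∃ Z' : List (Word Y), Z ⊆ Z' ∧ [] ∈ Z' ∧ (∀ y u, y :: u ∈ Z' → [y] ∈ Z' ∧ u ∈ Z') ∧
      ∀ z ∈ Z', ∀ p ∈ z, P p.1 := by
  refine ⟨[] :: (Z.flatMap List.tails ++ Z.flatten.map fun y => [y]), fun z hz => ?_, by simp,
    fun y u h => ?_, fun z hz p hp => ?_⟩
  · simp only [List.mem_cons, List.mem_append, List.mem_flatMap]
    exact Or.inr (Or.inl ⟨z, hz, by simp⟩)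
  · simp only [List.mem_cons, List.mem_append, List.mem_flatMap, List.mem_map, List.mem_flatten,
      List.mem_tails, reduceCtorEq, false_or] at h ⊢
    rcases h with ⟨z, hz, h⟩ | ⟨y', h, e⟩
    · exact ⟨Or.inr ⟨y, ⟨z, hz, h.subset List.mem_cons_self⟩, rfl⟩,
        Or.inr (Or.inl ⟨z, hz, (List.suffix_cons y u).trans h⟩)⟩
    · simp only [List.cons.injEq] at e
      obtain ⟨rfl, rfl⟩ := e
      exact ⟨Or.inr ⟨y', h, rfl⟩, Or.inl rfl⟩
  · simp only [List.mem_cons, List.mem_append, List.mem_flatMap, List.mem_map, List.mem_flatten,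
      List.mem_tails] at hz
    rcases hz with rfl | ⟨z', hz', h⟩ | ⟨y, ⟨z', hz', h⟩, rfl⟩
    · simp at hp
    · exact hZ z' hz' p (h.subset hp)
    · rw [List.mem_singleton] at hp
      exact hp ▸ hZ z' hz' y h

/-- The group element that a state stands for. -/
def State.elem {A : Type*} (w : Word (Option A)) (p : State A) : OneRelatorGroup w :=
  base w (mk p.1) * stable w ^ p.2

open Classical in
/-- All edges between states in `Q` with labels in `Z` that respect the submonoid `S`; labels of
length greater than one may only lead to states `t^k`. -/
noncomputable def semanticEdges {A : Type*} (w : Word (Option A)) (S : Submonoid (OneRelatorGroup w))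
    (Q : List (State A)) (Z : List (Word (A × ℤ))) : List (Edge A) :=
  (Q ×ˢ Z ×ˢ Q).filter fun e => (e.2.2.1 = [] ∨ e.2.1.length ≤ 1) ∧
    (State.elem w e.1)⁻¹ * base w (mk e.2.1) * State.elem w e.2.2 ∈ S

theorem mem_semanticEdges {A : Type*} {w : Word (Option A)} {S : Submonoid (OneRelatorGroup w)}
    {Q : List (State A)} {Z : List (Word (A × ℤ))} {p q : State A} {z : Word (A × ℤ)} :
    (p, z, q) ∈ semanticEdges w S Q Z ↔ (p ∈ Q ∧ z ∈ Z ∧ q ∈ Q) ∧ (q.1 = [] ∨ z.length ≤ 1) ∧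
      (p.elem w)⁻¹ * base w (mk z) * q.elem w ∈ S := by
  simp only [semanticEdges, List.mem_filter, decide_eq_true_eq, SProd.sprod, List.pair_mem_product]

/-- An edge labelled `y :: u` into `t^k` passes through the state `u t^k`. From there `u` leads to
`t^k` with group element `1`, and the first half keeps the element of the whole edge. This is why
long labels are admitted only into states `t^k`. -/
theorem isSplit_semanticEdges {A : Type*} {w : Word (Option A)}
    {S : Submonoid (OneRelatorGroup w)} {Z : List (Word (A × ℤ))} {I : List ℤ}
    (hZ : ∀ y u, y :: u ∈ Z → [y] ∈ Z ∧ u ∈ Z) : IsSplit (semanticEdges w S (Z ×ˢ I) Z) := by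
  rintro ⟨p, _ | ⟨y, u⟩, q⟩ h
  · exact Or.inl rfl
  · right
    obtain ⟨⟨hp, hz, hq⟩, hqz, hS⟩ := mem_semanticEdges.1 h
    obtain ⟨hy, hu⟩ := hZ y u hz
    rcases hqz with hq0 | hlen
    · obtain ⟨q, k⟩ := q
      obtain rfl : q = [] := hq0
      refine ⟨(p, [y], (u, k)), mem_semanticEdges.2 ⟨⟨hp, hy, ?_⟩, Or.inr (by simp), ?_⟩,
        ((u, k), u, ([], k)), mem_semanticEdges.2 ⟨⟨?_, hu, hq⟩, Or.inl rfl, ?_⟩,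
        rfl, rfl, rfl, rfl, rfl⟩
      · exact List.mem_product.2 ⟨hu, (List.mem_product.1 hq).2⟩
      · convert hS using 1
        have e : base w (mk (y :: u)) = base w (mk [y]) * base w (mk u) := by
          rw [← map_mul, ← mk_append]
          rfl
        simp only [e, State.elem, ← one_eq_mk, map_one, mul_assoc, one_mul]
      · exact List.mem_product.2 ⟨hu, (List.mem_product.1 hq).2⟩
      · convert S.one_mem using 1
        simp [State.elem, ← one_eq_mk]
    · obtain rfl : u = [] := by simpa using hlen
      exact ⟨(p, [y], q), h, (q, [], q), mem_semanticEdges.2 ⟨⟨hq, hu, hq⟩, Or.inr (by simp),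
        by simp [← one_eq_mk]⟩, rfl, rfl, rfl, rfl, rfl⟩

/-- Two short labels either cancel, or one of them is empty; an uncancelled pair of letters is too
long. -/
theorem reduce_append_mem {X : Type*} [DecidableEq X] {Z : List (Word X)} (h0 : [] ∈ Z)
    {u v : Word X} (hu : u ∈ Z) (hv : v ∈ Z) (hul : u.length ≤ 1) (hvl : v.length ≤ 1)
    (h : (reduce (u ++ v)).length ≤ 1) : reduce (u ++ v) ∈ Z := by
  match u, v with
  | [], [] => simpa using h0
  | [], [y] => simpa [reduce.cons] using hv
  | [y], [] => simpa [reduce.cons] using hu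
  | [y], [z] =>
    simp only [List.singleton_append, reduce.cons, reduce_nil] at h ⊢
    split_ifs at h ⊢
    · exact h0
    · simp at h
  | _ :: _ :: _, _ => simp at hul
  | _, _ :: _ :: _ => simp at hvl

/-- The elements `p⁻¹ u q` and `q⁻¹ v r` multiply to `p⁻¹ u v r`, and `S` is closed under products.
-/
theorem isSaturated_semanticEdges {w : Word (Option A)} {S : Submonoid (OneRelatorGroup w)}
    {Q : List (State A)} {Z : List (Word (A × ℤ))} (h0 : [] ∈ Z) :
    IsSaturated (semanticEdges w S Q Z) := by
  rintro ⟨p, u, q⟩ h₁ ⟨q', v, r⟩ h₂ ⟨e, hul, hvl, hl⟩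
  obtain rfl : q = q' := e
  obtain ⟨⟨hp, hu, hq⟩, -, hS⟩ := mem_semanticEdges.1 h₁
  obtain ⟨⟨-, hv, hr⟩, -, hS'⟩ := mem_semanticEdges.1 h₂
  refine mem_semanticEdges.2 ⟨⟨hp, reduce_append_mem h0 hu hv hul hvl hl, hr⟩, Or.inr hl, ?_⟩
  convert S.mul_mem hS hS' using 1
  rw [reduce.self, mk_append, map_mul]
  group

/-- The automaton consists of all edges that are true with respect to the submonoid. It need not be
computable from the input: only its existence matters, since a search will find it. -/
theorem exists_refutes (h : IsPivot w x M m) (hw : expSum w = 0) (hws : ∀ u ∈ ws, 0 ≤ expSum u)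
    (hτ : val w τ ∉ submonoidOf w ws) : ∃ D K T, Refutes w ws τ x M m D K T := by
  choose b hb hb' using h.exists_basic_word hw
  -- Truncation by `toNat` keeps height `0` in `K` even when `τ` has negative exponent sum.
  let K : List ℤ := (List.range ((expSum τ).toNat + 1)).map Int.ofNat
  have hK : ∀ k : ℤ, k ∈ K ↔ 0 ≤ k ∧ (k = 0 ∨ k ≤ expSum τ) := by
    intro k
    simp only [K, List.mem_map, List.mem_range]
    constructor
    · rintro ⟨n, hn, rfl⟩
      simp only [Int.ofNat_eq_natCast]
      omega
    · intro hk
      exact ⟨k.toNat, by omega, by simp; omega⟩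
  -- The initial state is `(f, 0)`, from which `f` leads to `([], 0)` with group element `1`.
  let f : Word (A × ℤ) := b (mk (rewrite τ))⁻¹
  let g : ℤ → Word (Option A) → Word (A × ℤ) := fun k u => b (mk (rewriteFrom k u))
  obtain ⟨Z, hsub, h0, hZ, hbas⟩ := exists_closed_words (IsBasic x M m)
    (f :: K.flatMap fun k => ws.map (g k)) (by
      intro z hz
      simp only [List.mem_cons, List.mem_flatMap, List.mem_map] at hz
      rcases hz with rfl | ⟨k, -, u, -, rfl⟩
      · exact hb _
      · exact hb _)
  have hf : f ∈ Z := hsub List.mem_cons_self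
  have hg : ∀ k ∈ K, ∀ u ∈ ws, g k u ∈ Z := fun k hk u hu => hsub <| List.mem_cons_of_mem _ <|
    List.mem_flatMap.2 ⟨k, hk, List.mem_map.2 ⟨u, hu, rfl⟩⟩
  obtain ⟨D, hD⟩ := exists_derives hw
    ((f ++ rewrite τ, []) :: K.flatMap fun k => ws.map fun u => (g k u, rewriteFrom k u)) (by
      intro z hz
      simp only [List.mem_cons, List.mem_flatMap, List.mem_map] at hz
      rcases hz with rfl | ⟨k, -, u, -, rfl⟩
      · rw [mk_append, map_mul, hb', map_inv, inv_mul_cancel, ← one_eq_mk, map_one]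
      · exact hb' _)
  have hQ : ∀ u ∈ Z, ∀ k, k = expSum τ ∨ k ∈ K → (u, k) ∈ Z ×ˢ (expSum τ :: K) :=
    fun u hu k hk => List.mem_product.2 ⟨hu, List.mem_cons.2 hk⟩
  have h0K : (0 : ℤ) ∈ K := (hK 0).2 ⟨le_rfl, Or.inl rfl⟩
  have hbτ : base w (mk (rewrite τ)) = val w τ * (stable w ^ expSum τ)⁻¹ := by
    simp [rewrite, base_rewriteFrom]
  refine ⟨D, K, semanticEdges w (submonoidOf w ws) (Z ×ˢ (expSum τ :: K)) Z, h, ?_,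
    isSplit_semanticEdges hZ, isSaturated_semanticEdges h0, h0K, ?_, ?_⟩
  · rintro ⟨p, z, q⟩ he
    exact hbas z (mem_semanticEdges.1 he).1.2.1
  · intro k hk u hu hle
    have hk' : k + expSum u ∈ K := by
      have := hws u hu
      rw [hK] at hk ⊢
      omega
    refine ⟨hk', (([], k), g k u, ([], k + expSum u)), mem_semanticEdges.2
      ⟨⟨hQ _ h0 _ (Or.inr hk), hg k hk u hu, hQ _ h0 _ (Or.inr hk')⟩, Or.inl rfl, ?_⟩, rfl, rfl, ?_⟩
    · rw [hb', base_rewriteFrom]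
      refine Submonoid.subset_closure ⟨u, hu, ?_⟩
      simp [State.elem, ← one_eq_mk, mul_assoc]
    · exact hD _ <| List.mem_cons_of_mem _ <|
        List.mem_flatMap.2 ⟨k, hk, List.mem_map.2 ⟨u, hu, rfl⟩⟩
  · refine ⟨((f, 0), f, ([], 0)), mem_semanticEdges.2
      ⟨⟨hQ _ hf _ (Or.inr h0K), hf, hQ _ h0 _ (Or.inr h0K)⟩, Or.inl rfl, ?_⟩, rfl,
      hD _ List.mem_cons_self, fun hmem => hτ ?_⟩
    · convert (submonoidOf w ws).one_mem using 1
      simp [State.elem, ← one_eq_mk]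
    -- The excluded edge has group element `f⁻¹ t^{σ(τ)}`, which is `τ` itself.
    · convert (mem_semanticEdges.1 hmem).2.2 using 1
      rw [State.elem, State.elem, hb', map_inv, hbτ]
      simp [← one_eq_mk]

/-- A finite certificate for the fact that `τ` represents an element of the submonoid that the words
in `ws` generate. -/
def Confirms (w : Word (Option A)) (ws : List (Word (Option A))) (τ : Word (Option A))
    (L : List (Word (Option A))) (D : List (Derivation A)) : Prop :=
  (∀ u ∈ L, u ∈ ws) ∧ expSum τ = expSum L.flatten ∧ Derives w D (rewrite τ) (rewrite L.flatten)

theorem mem_iff_exists_confirms (hw : expSum w = 0) :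
    val w τ ∈ submonoidOf w ws ↔ ∃ L D, Confirms w ws τ L D := by
  rw [mem_submonoidOf_iff]
  refine exists_congr fun L => ?_
  constructor
  · rintro ⟨hL, h⟩
    obtain ⟨he, hb⟩ := (val_eq_val_iff hw).1 h
    obtain ⟨D, hD⟩ := exists_derives hw [(rewrite τ, rewrite L.flatten)] (by simpa using hb)
    exact ⟨D, hL, he, hD _ List.mem_cons_self⟩
  · rintro ⟨D, hL, he, hd⟩
    exact ⟨hL, (val_eq_val_iff hw).2 ⟨he, hd.base_eq hw⟩⟩

end Refutation

/-! ### Primitive recursiveness of the certificate checks. -/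

section Computability

/-- An integer and its image in `ℕ ⊕ ℕ` have the same code. -/
theorem primrec_intEquivNatSumNat : Primrec Equiv.intEquivNatSumNat := by
  refine Primrec.encode_iff.1 (Primrec.encode.of_eq fun i => ?_)
  cases i <;> rfl

theorem primrec_intEquivNatSumNat_symm : Primrec Equiv.intEquivNatSumNat.symm := by
  refine Primrec.encode_iff.1 (Primrec.encode.of_eq fun s => ?_)
  cases s <;> rfl

theorem primrec_ofNat : Primrec Int.ofNat :=
  (primrec_intEquivNatSumNat_symm.comp Primrec.sumInl).of_eq fun _ => rfl

theorem primrec_negSucc : Primrec Int.negSucc :=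
  (primrec_intEquivNatSumNat_symm.comp Primrec.sumInr).of_eq fun _ => rfl

theorem primrec_int_cases {α σ : Type*} [Primcodable α] [Primcodable σ] {f : α → ℤ} {g : α → ℤ → σ}
    (hf : Primrec f) (h₁ : Primrec₂ fun a (n : ℕ) => g a (Int.ofNat n))
    (h₂ : Primrec₂ fun a n => g a (Int.negSucc n)) : Primrec fun a => g a (f a) := by
  refine (Primrec.sumCasesOn (primrec_intEquivNatSumNat.comp hf) h₁ h₂).of_eq fun a => ?_
  cases f a <;> rfl

theorem primrec_int_succ : Primrec fun i : ℤ => i + 1 := by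
  refine primrec_int_cases (α := ℤ) (f := id) (g := fun _ i => i + 1) Primrec.id ?_ ?_
  · exact (primrec_ofNat.comp (Primrec.succ.comp Primrec.snd)).of_eq fun _ => rfl
  · refine (Primrec.nat_casesOn (f := fun p : ℤ × ℕ => p.2) (g := fun _ => (0 : ℤ))
      (h := fun _ n => Int.negSucc n) Primrec.snd (Primrec.const _)
      (primrec_negSucc.comp Primrec.snd)).of_eq ?_
    rintro ⟨a, _ | n⟩ <;> rfl

theorem primrec_int_pred : Primrec fun i : ℤ => i - 1 := by
  refine primrec_int_cases (α := ℤ) (f := id) (g := fun _ i => i - 1) Primrec.id ?_ ?_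
  · refine (Primrec.nat_casesOn (f := fun p : ℤ × ℕ => p.2) (g := fun _ => (-1 : ℤ))
      (h := fun _ n => Int.ofNat n) Primrec.snd (Primrec.const _)
      (primrec_ofNat.comp Primrec.snd)).of_eq ?_
    rintro ⟨a, _ | n⟩
    · rfl
    · simp
  · exact (primrec_negSucc.comp (Primrec.succ.comp Primrec.snd)).of_eq fun _ => rfl

theorem primrecRel_int_le : PrimrecRel fun i j : ℤ => i ≤ j := by
  refine Primrec₂.primrecRel ?_
  refine primrec_int_cases (f := fun p : ℤ × ℤ => p.1) (g := fun p i => decide (i ≤ p.2))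
    Primrec.fst ?_ ?_
  · refine primrec_int_cases (f := fun p : (ℤ × ℤ) × ℕ => p.1.2)
      (g := fun p j => decide (Int.ofNat p.2 ≤ j)) (Primrec.snd.comp Primrec.fst) ?_ ?_
    · refine (Primrec.nat_le.decide.comp (Primrec.snd.comp Primrec.fst) Primrec.snd).of_eq ?_
      rintro ⟨⟨_, n⟩, m⟩
      simp
    · refine (Primrec.const false).of_eq ?_
      rintro ⟨⟨_, n⟩, m⟩
      simp
      omega
  · refine primrec_int_cases (f := fun p : (ℤ × ℤ) × ℕ => p.1.2)
      (g := fun p j => decide (Int.negSucc p.2 ≤ j)) (Primrec.snd.comp Primrec.fst) ?_ ?_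
    · refine (Primrec.const true).of_eq ?_
      rintro ⟨⟨_, n⟩, m⟩
      simp
      omega
    · refine (Primrec.nat_le.decide.comp Primrec.snd (Primrec.snd.comp Primrec.fst)).of_eq ?_
      rintro ⟨⟨_, n⟩, m⟩
      simp
      omega

theorem PrimrecPred.exists_mem {α β : Type*} [Primcodable α] [Primcodable β] {f : α → List β}
    {R : α → β → Prop} (hf : Primrec f) (hR : PrimrecPred fun q : α × β => R q.1 q.2) :
    PrimrecPred fun a => ∃ b ∈ f a, R a b :=
  PrimrecRel.comp (PrimrecRel.exists_mem_list (R := fun b a => R a b)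
    (hR.comp (Primrec.pair Primrec.snd Primrec.fst))) hf Primrec.id

theorem PrimrecPred.forall_mem {α β : Type*} [Primcodable α] [Primcodable β] {f : α → List β}
    {R : α → β → Prop} (hf : Primrec f) (hR : PrimrecPred fun q : α × β => R q.1 q.2) :
    PrimrecPred fun a => ∀ b ∈ f a, R a b :=
  PrimrecRel.comp (PrimrecRel.forall_mem_list (R := fun b a => R a b)
    (hR.comp (Primrec.pair Primrec.snd Primrec.fst))) hf Primrec.id

theorem PrimrecPred.imp {α : Type*} [Primcodable α] {p q : α → Prop} (hp : PrimrecPred p)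
    (hq : PrimrecPred q) : PrimrecPred fun a => p a → q a :=
  (hp.not.or hq).of_eq fun _ => imp_iff_not_or.symm

theorem PrimrecPred.mem {α β : Type*} [Primcodable α] [Primcodable β] {f : α → List β} {g : α → β}
    (hf : Primrec f) (hg : Primrec g) : PrimrecPred fun a => g a ∈ f a :=
  (PrimrecPred.exists_mem (R := fun a b => b = g a) hf
    (Primrec.eq.comp Primrec.snd (hg.comp Primrec.fst))).of_eq fun _ => by simp

section Words

variable {α A : Type*} [Primcodable α] [Primcodable A]

/-- The sum is reached from `k` by successor and predecessor steps, so integer addition is not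
needed. -/
theorem primrec_add_expSum {k : α → ℤ} {u : α → Word (Option A)} (hk : Primrec k)
    (hu : Primrec u) : Primrec fun a => k a + expSum (u a) := by
  have hstep : Primrec₂ fun (_ : α) (q : ℤ × (Option A × Bool)) =>
      Option.casesOn (motive := fun _ => ℤ) q.2.1 (cond q.2.2 (q.1 + 1) (q.1 - 1))
        fun _ => q.1 := by
    refine Primrec.option_casesOn (Primrec.fst.comp (Primrec.snd.comp Primrec.snd)) ?_ ?_
    · exact Primrec.cond (Primrec.snd.comp (Primrec.snd.comp Primrec.snd))
        (primrec_int_succ.comp (Primrec.fst.comp Primrec.snd))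
        (primrec_int_pred.comp (Primrec.fst.comp Primrec.snd))
    · exact Primrec.fst.comp (Primrec.snd.comp Primrec.fst)
  refine (Primrec.list_foldl hu hk hstep).of_eq fun a => ?_
  generalize k a = i
  generalize u a = l
  induction l generalizing i with
  | nil => simp [expSum]
  | cons p l ih =>
    rw [List.foldl_cons, ih]
    obtain ⟨_ | _, _ | _⟩ := p <;> simp [expSum] <;> ring

theorem primrec_rewriteFrom {k : α → ℤ} {u : α → Word (Option A)} (hk : Primrec k)
    (hu : Primrec u) : Primrec fun a => rewriteFrom (k a) (u a) := by
  -- The left fold carries the current height and the output so far.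
  have hstep : Primrec₂ fun (_ : α) (q : (ℤ × Word (A × ℤ)) × (Option A × Bool)) =>
      Option.casesOn (motive := fun _ => ℤ × Word (A × ℤ)) q.2.1
        (cond q.2.2 (q.1.1 + 1, q.1.2) (q.1.1 - 1, q.1.2))
        fun a => (q.1.1, q.1.2 ++ [((a, q.1.1), q.2.2)]) := by
    refine Primrec.option_casesOn (Primrec.fst.comp (Primrec.snd.comp Primrec.snd)) ?_ ?_
    · have h1 := (Primrec.fst (α := ℤ) (β := Word (A × ℤ))).comp ((Primrec.fst
        (β := Option A × Bool)).comp (Primrec.snd (α := α)))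
      have h2 := (Primrec.snd (α := ℤ) (β := Word (A × ℤ))).comp ((Primrec.fst
        (β := Option A × Bool)).comp (Primrec.snd (α := α)))
      exact Primrec.cond (Primrec.snd.comp (Primrec.snd.comp Primrec.snd))
        (Primrec.pair (primrec_int_succ.comp h1) h2) (Primrec.pair (primrec_int_pred.comp h1) h2)
    · have hq : Primrec fun p : (α × (ℤ × Word (A × ℤ)) × (Option A × Bool)) × A => p.1.2 :=
        Primrec.snd.comp Primrec.fst
      have h1 := Primrec.fst.comp (Primrec.fst.comp hq)
      have h2 := Primrec.snd.comp (Primrec.fst.comp hq)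
      exact Primrec.pair h1 (Primrec.list_concat.comp h2
        (Primrec.pair (Primrec.pair Primrec.snd h1) (Primrec.snd.comp (Primrec.snd.comp hq))))
  refine (Primrec.snd.comp (Primrec.list_foldl hu
    (Primrec.pair hk (Primrec.const ([] : Word (A × ℤ)))) hstep)).of_eq fun a => ?_
  suffices ∀ (l : Word (Option A)) (i : ℤ) (v : Word (A × ℤ)),
      (l.foldl (fun (s : ℤ × Word (A × ℤ)) (b : Option A × Bool) =>
        Option.casesOn (motive := fun _ => ℤ × Word (A × ℤ)) b.1
          (cond b.2 (s.1 + 1, s.2) (s.1 - 1, s.2))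
          fun a => (s.1, s.2 ++ [((a, s.1), b.2)])) (i, v)).2 = v ++ rewriteFrom i l from
    this (u a) (k a) []
  intro l
  induction l with
  | nil => simp [rewriteFrom]
  | cons p l ih =>
    intro i v
    rw [List.foldl_cons]
    obtain ⟨_ | _, _ | _⟩ := p <;> simp [rewriteFrom, ih]

theorem primrec_reduce [DecidableEq A] : Primrec (reduce : Word A → Word A) := by
  have hstep : Primrec₂ fun (_ : Word A) (q : (A × Bool) × Word A) =>
      List.casesOn (motive := fun _ => Word A) q.2 [q.1] fun hd tl =>
        if q.1.1 = hd.1 ∧ q.1.2 = !hd.2 then tl else q.1 :: hd :: tl := by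
    refine Primrec.list_casesOn (f := fun p : Word A × (A × Bool) × Word A => p.2.2)
      (g := fun p => [p.2.1])
      (h := fun p q => if p.2.1.1 = q.1.1 ∧ p.2.1.2 = !q.1.2 then q.2 else p.2.1 :: q.1 :: q.2)
      (Primrec.snd.comp Primrec.snd)
      (Primrec.list_cons.comp (Primrec.fst.comp Primrec.snd) (Primrec.const [])) ?_
    have hq : Primrec fun p : (Word A × (A × Bool) × Word A) × (A × Bool) × Word A => p.1.2.1 :=
      Primrec.fst.comp (Primrec.snd.comp Primrec.fst)
    have hh : Primrec fun p : (Word A × (A × Bool) × Word A) × (A × Bool) × Word A => p.2.1 :=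
      Primrec.fst.comp Primrec.snd
    have ht : Primrec fun p : (Word A × (A × Bool) × Word A) × (A × Bool) × Word A => p.2.2 :=
      Primrec.snd.comp Primrec.snd
    exact Primrec.ite ((Primrec.eq.comp (Primrec.fst.comp hq) (Primrec.fst.comp hh)).and
      (Primrec.eq.comp (Primrec.snd.comp hq) (Primrec.not.comp (Primrec.snd.comp hh)))) ht
      (Primrec.list_cons.comp hq (Primrec.list_cons.comp hh ht))
  refine (Primrec.list_foldr (f := fun l : Word A => l) (g := fun _ => ([] : Word A))
    Primrec.id (Primrec.const []) hstep).of_eq fun l => ?_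
  induction l with
  | nil => rfl
  | cons p l ih =>
    rw [reduce.cons, ← ih]
    rfl

theorem primrec_invRev : Primrec (invRev : Word A → Word A) :=
  Primrec.list_reverse.comp (Primrec.list_map Primrec.id
    (Primrec.pair (Primrec.fst.comp Primrec.snd) (Primrec.not.comp (Primrec.snd.comp Primrec.snd))))

theorem primrec_conjProd {w : α → Word (Option A)} {d : α → Derivation A} (hw : Primrec w)
    (hd : Primrec d) : Primrec fun a => conjProd (w a) (d a) := by
  refine Primrec.list_flatMap hd ?_
  have hr : Primrec fun q : α × (Word (A × ℤ) × ℤ × Bool) => rewriteFrom q.2.2.1 (w q.1) :=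
    primrec_rewriteFrom (Primrec.fst.comp (Primrec.snd.comp Primrec.snd)) (hw.comp Primrec.fst)
  have hc : Primrec fun q : α × (Word (A × ℤ) × ℤ × Bool) => q.2.1 :=
    Primrec.fst.comp Primrec.snd
  exact Primrec.list_append.comp hc (Primrec.list_append.comp
    (Primrec.cond (Primrec.snd.comp (Primrec.snd.comp Primrec.snd)) hr (primrec_invRev.comp hr))
    (primrec_invRev.comp hc))

theorem primrecPred_derives [DecidableEq A] {w : α → Word (Option A)}
    {D : α → List (Derivation A)} {u v : α → Word (A × ℤ)} (hw : Primrec w) (hD : Primrec D)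
    (hu : Primrec u) (hv : Primrec v) : PrimrecPred fun a => Derives (w a) (D a) (u a) (v a) :=
  PrimrecPred.exists_mem hD <| Primrec.eq.comp (primrec_reduce.comp (hu.comp Primrec.fst))
    (primrec_reduce.comp (Primrec.list_append.comp
      (primrec_conjProd (hw.comp Primrec.fst) Primrec.snd) (hv.comp Primrec.fst)))

theorem primrec_occ [DecidableEq A] {y : α → A} {u : α → Word A} (hy : Primrec y)
    (hu : Primrec u) : Primrec fun a => occ (y a) (u a) := by
  have hstep : Primrec₂ fun (a : α) (q : (A × Bool) × ℕ) =>
      if q.1.1 = y a then q.2 + 1 else q.2 :=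
    Primrec.ite (Primrec.eq.comp (Primrec.fst.comp (Primrec.fst.comp Primrec.snd))
      (hy.comp Primrec.fst)) (Primrec.succ.comp (Primrec.snd.comp Primrec.snd))
      (Primrec.snd.comp Primrec.snd)
  refine (Primrec.list_foldr hu (Primrec.const 0) hstep).of_eq fun a => ?_
  generalize u a = l
  induction l with
  | nil => rfl
  | cons p l ih =>
    rw [List.foldr_cons, ih]
    simp only [occ, List.map_cons, List.count_cons, beq_iff_eq]
    split_ifs <;> simp

theorem primrecPred_isPivot [DecidableEq A] {w : α → Word (Option A)} {x : α → A} {M m : α → ℤ}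
    (hw : Primrec w) (hx : Primrec x) (hM : Primrec M) (hm : Primrec m) :
    PrimrecPred fun a => IsPivot (w a) (x a) (M a) (m a) := by
  have hr : Primrec fun a => rewrite (w a) := primrec_rewriteFrom (Primrec.const 0) hw
  refine (Primrec.eq.comp (primrec_occ (Primrec.pair hx hM) hr) (Primrec.const 1)).and
    ((Primrec.eq.comp (primrec_occ (Primrec.pair hx hm) hr) (Primrec.const 1)).and
    (PrimrecPred.forall_mem hr (PrimrecPred.imp ?_ (PrimrecPred.and ?_ ?_))))
  · exact Primrec.eq.comp (Primrec.fst.comp (Primrec.fst.comp Primrec.snd)) (hx.comp Primrec.fst)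
  · exact primrecRel_int_le.comp (hm.comp Primrec.fst)
      (Primrec.snd.comp (Primrec.fst.comp Primrec.snd))
  · exact primrecRel_int_le.comp (Primrec.snd.comp (Primrec.fst.comp Primrec.snd))
      (hM.comp Primrec.fst)

theorem primrecPred_isBasic {x : α → A} {M m : α → ℤ} {y : α → A × ℤ} (hx : Primrec x)
    (hM : Primrec M) (hm : Primrec m) (hy : Primrec y) :
    PrimrecPred fun a => IsBasic (x a) (M a) (m a) (y a) :=
  PrimrecPred.imp (Primrec.eq.comp (Primrec.fst.comp hy) hx)
    ((primrecRel_int_le.comp hm (Primrec.snd.comp hy)).and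
      ((primrecRel_int_le.comp hM (Primrec.snd.comp hy)).not.of_eq fun _ => not_le))

theorem primrecPred_isSplit {T : α → List (Edge A)} (hT : Primrec T) :
    PrimrecPred fun a => IsSplit (T a) := by
  have src : Primrec fun e : Edge A => e.1 := Primrec.fst
  have lab : Primrec fun e : Edge A => e.2.1 := Primrec.fst.comp Primrec.snd
  have tgt : Primrec fun e : Edge A => e.2.2 := Primrec.snd.comp Primrec.snd
  refine PrimrecPred.forall_mem hT (PrimrecPred.or ?_ ?_)
  · exact Primrec.eq.comp (lab.comp Primrec.snd) (Primrec.const [])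
  refine PrimrecPred.exists_mem (hT.comp Primrec.fst) (PrimrecPred.exists_mem
    (hT.comp (Primrec.fst.comp Primrec.fst)) ?_)
  have e : Primrec fun q : ((α × Edge A) × Edge A) × Edge A => q.1.1.2 :=
    Primrec.snd.comp (Primrec.fst.comp Primrec.fst)
  have e₁ : Primrec fun q : ((α × Edge A) × Edge A) × Edge A => q.1.2 :=
    Primrec.snd.comp Primrec.fst
  have e₂ : Primrec fun q : ((α × Edge A) × Edge A) × Edge A => q.2 := Primrec.snd
  exact (Primrec.eq.comp (src.comp e₁) (src.comp e)).and <|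
    (Primrec.eq.comp (lab.comp e₁) (Primrec.list_take.comp (Primrec.const 1) (lab.comp e))).and <|
    (Primrec.eq.comp (tgt.comp e₁) (src.comp e₂)).and <|
    (Primrec.eq.comp (lab.comp e₂) (Primrec.list_tail.comp (lab.comp e))).and <|
    Primrec.eq.comp (tgt.comp e₂) (tgt.comp e)

theorem primrecPred_isSaturated [DecidableEq A] {T : α → List (Edge A)} (hT : Primrec T) :
    PrimrecPred fun a => IsSaturated (T a) := by
  have src : Primrec fun e : Edge A => e.1 := Primrec.fst
  have lab : Primrec fun e : Edge A => e.2.1 := Primrec.fst.comp Primrec.snd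
  have tgt : Primrec fun e : Edge A => e.2.2 := Primrec.snd.comp Primrec.snd
  have e₁ : Primrec fun q : (α × Edge A) × Edge A => q.1.2 := Primrec.snd.comp Primrec.fst
  have e₂ : Primrec fun q : (α × Edge A) × Edge A => q.2 := Primrec.snd
  have hr : Primrec fun q : (α × Edge A) × Edge A => reduce (q.1.2.2.1 ++ q.2.2.1) :=
    primrec_reduce.comp (Primrec.list_append.comp (lab.comp e₁) (lab.comp e₂))
  have short : ∀ {f : (α × Edge A) × Edge A → Word (A × ℤ)}, Primrec f →
      PrimrecPred fun q => (f q).length ≤ 1 := fun hf =>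
    Primrec.nat_le.comp (Primrec.list_length.comp hf) (Primrec.const 1)
  refine PrimrecPred.forall_mem hT (PrimrecPred.forall_mem (hT.comp Primrec.fst)
    (PrimrecPred.imp ?_ ?_))
  · exact (Primrec.eq.comp (tgt.comp e₁) (src.comp e₂)).and <|
      (short (lab.comp e₁)).and <| (short (lab.comp e₂)).and (short hr)
  · exact PrimrecPred.mem (hT.comp (Primrec.fst.comp Primrec.fst))
      (Primrec.pair (src.comp e₁) (Primrec.pair hr (tgt.comp e₂)))

end Words

end Computability

/-! ### Decision by two parallel searches. -/

section Decidability

theorem rePred_exists {α β : Type*} [Primcodable α] [Primcodable β] {R : α → β → Prop}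
    (hR : PrimrecPred fun q : α × β => R q.1 q.2) : REPred fun a => ∃ b, R a b := by
  classical
  have hf : Computable₂ fun (a : α) (n : ℕ) => (Encodable.decode (α := β) n).bind fun b =>
      if R a b then some () else none := by
    refine Primrec₂.to_comp (Primrec.option_bind (Primrec.decode.comp Primrec.snd) ?_)
    exact Primrec.ite (hR.comp (Primrec.pair (Primrec.fst.comp Primrec.fst) Primrec.snd))
      (Primrec.const _) (Primrec.const _)
  refine (Partrec.rfindOpt hf).dom_re.of_eq fun a => ?_
  rw [Nat.rfindOpt_dom]
  constructor
  · rintro ⟨n, _, h⟩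
    obtain ⟨b, -, hb⟩ := Option.bind_eq_some_iff.1 h
    by_contra hn
    rw [if_neg fun hab => hn ⟨b, hab⟩] at hb
    exact Option.some_ne_none _ hb.symm
  · rintro ⟨b, hb⟩
    exact ⟨Encodable.encode b, (), by simp [hb]⟩

theorem rePred_or_exists {α β : Type*} [Primcodable α] [Primcodable β] {P : α → Prop}
    {R : α → β → Prop} (hP : PrimrecPred P) (hR : PrimrecPred fun q : α × β => R q.1 q.2) :
    REPred fun a => P a ∨ ∃ b, R a b := by
  -- `Option β` is never empty, so `P a` alone has a witness even if `β` is empty, as happens for an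
  -- empty alphabet.
  refine (rePred_exists (β := Option β) (R := fun a o => P a ∨ ∃ b ∈ o.toList, R a b)
    ((hP.comp Primrec.fst).or (PrimrecPred.exists_mem (Primrec.optionToList.comp Primrec.snd)
      (hR.comp (Primrec.pair (Primrec.fst.comp Primrec.fst) Primrec.snd))))).of_eq fun a => ?_
  constructor
  · rintro ⟨o, h | ⟨b, -, h⟩⟩
    · exact Or.inl h
    · exact Or.inr ⟨b, h⟩
  · rintro (h | ⟨b, h⟩)
    · exact ⟨none, Or.inl h⟩
    · exact ⟨some b, Or.inr ⟨b, by simp, h⟩⟩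

variable {A : Type*} [DecidableEq A]

/-- The conditions under which the membership problem is decided. -/
def IsValid (w : Word (Option A)) (ws : List (Word (Option A))) : Prop :=
  expSum w = 0 ∧ MaxMinCondition w ∧ ∀ u ∈ ws, 0 ≤ expSum u

/-- The extreme letters occur in the rewrite, so a bounded search suffices. -/
theorem maxMinCondition_iff_exists_mem (w : Word (Option A)) : MaxMinCondition w ↔
    ∃ p ∈ rewrite w, ∃ q ∈ rewrite w, IsPivot w p.1.1 p.1.2 q.1.2 := by
  rw [maxMinCondition_iff]
  constructor
  · rintro ⟨x, M, m, h⟩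
    obtain ⟨b, hb⟩ := occ_pos_iff.1 (h.1 ▸ Nat.one_pos)
    obtain ⟨c, hc⟩ := occ_pos_iff.1 (h.2.1 ▸ Nat.one_pos)
    exact ⟨_, hb, _, hc, h⟩
  · rintro ⟨p, -, q, -, h⟩
    exact ⟨_, _, _, h⟩

variable [Primcodable A]

theorem primrecPred_isValid : PrimrecPred
    fun a : Word (Option A) × List (Word (Option A)) => IsValid a.1 a.2 := by
  refine (Primrec.eq.comp ((primrec_add_expSum (Primrec.const 0) Primrec.fst).of_eq
    fun a => zero_add _) (Primrec.const 0)).and (PrimrecPred.and ?_ ?_)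
  · have hr : Primrec fun a : Word (Option A) × List (Word (Option A)) => rewrite a.1 :=
      primrec_rewriteFrom (Primrec.const 0) Primrec.fst
    refine PrimrecPred.of_eq (PrimrecPred.exists_mem hr (PrimrecPred.exists_mem
      (hr.comp Primrec.fst) (primrecPred_isPivot (Primrec.fst.comp (Primrec.fst.comp Primrec.fst))
      ?_ ?_ ?_))) fun a => (maxMinCondition_iff_exists_mem a.1).symm
    · exact Primrec.fst.comp (Primrec.fst.comp (Primrec.snd.comp Primrec.fst))
    · exact Primrec.snd.comp (Primrec.fst.comp (Primrec.snd.comp Primrec.fst))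
    · exact Primrec.snd.comp (Primrec.fst.comp Primrec.snd)
  · exact PrimrecPred.forall_mem Primrec.snd (primrecRel_int_le.comp (Primrec.const 0)
      ((primrec_add_expSum (Primrec.const 0) Primrec.snd).of_eq fun a => zero_add _))

theorem primrecPred_confirms {α : Type*} [Primcodable α] {w τ : α → Word (Option A)}
    {ws L : α → List (Word (Option A))} {D : α → List (Derivation A)} (hw : Primrec w)
    (hws : Primrec ws) (hτ : Primrec τ) (hL : Primrec L) (hD : Primrec D) :
    PrimrecPred fun a => Confirms (w a) (ws a) (τ a) (L a) (D a) := by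
  have hexp : ∀ {u : α → Word (Option A)}, Primrec u → Primrec fun a => expSum (u a) := fun hu =>
    (primrec_add_expSum (Primrec.const 0) hu).of_eq fun a => zero_add _
  have hflat := Primrec.list_flatten.comp hL
  exact (PrimrecPred.forall_mem hL (PrimrecPred.mem (hws.comp Primrec.fst) Primrec.snd)).and <|
    (Primrec.eq.comp (hexp hτ) (hexp hflat)).and <| primrecPred_derives hw hD
      (primrec_rewriteFrom (Primrec.const 0) hτ) (primrec_rewriteFrom (Primrec.const 0) hflat)

theorem primrecPred_refutes {α : Type*} [Primcodable α] {w τ : α → Word (Option A)}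
    {ws : α → List (Word (Option A))} {x : α → A} {M m : α → ℤ} {D : α → List (Derivation A)}
    {K : α → List ℤ} {T : α → List (Edge A)} (hw : Primrec w) (hws : Primrec ws) (hτ : Primrec τ)
    (hx : Primrec x) (hM : Primrec M) (hm : Primrec m) (hD : Primrec D) (hK : Primrec K)
    (hT : Primrec T) : PrimrecPred fun a =>
      Refutes (w a) (ws a) (τ a) (x a) (M a) (m a) (D a) (K a) (T a) := by
  have src : Primrec fun e : Edge A => e.1 := Primrec.fst
  have lab : Primrec fun e : Edge A => e.2.1 := Primrec.fst.comp Primrec.snd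
  have tgt : Primrec fun e : Edge A => e.2.2 := Primrec.snd.comp Primrec.snd
  have hexp : Primrec fun a => expSum (τ a) :=
    (primrec_add_expSum (Primrec.const 0) hτ).of_eq fun a => zero_add _
  have root : ∀ {β : Type _} [Primcodable β] {k : β → ℤ}, Primrec k →
      Primrec fun a => (([], k a) : State A) := fun hk => Primrec.pair (Primrec.const []) hk
  refine (primrecPred_isPivot hw hx hM hm).and <| PrimrecPred.and ?_ <|
    (primrecPred_isSplit hT).and <| (primrecPred_isSaturated hT).and <|
    (PrimrecPred.mem hK (Primrec.const 0)).and <| PrimrecPred.and ?_ ?_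
  · have p1 : Primrec fun q : (α × Edge A) × (A × ℤ) × Bool => q.1.1 := Primrec.fst.comp Primrec.fst
    exact PrimrecPred.forall_mem hT (PrimrecPred.forall_mem (lab.comp Primrec.snd)
      (primrecPred_isBasic (hx.comp p1) (hM.comp p1) (hm.comp p1)
        (Primrec.fst.comp Primrec.snd)))
  · have ha : Primrec fun q : (α × ℤ) × Word (Option A) => q.1.1 := Primrec.fst.comp Primrec.fst
    have hk : Primrec fun q : (α × ℤ) × Word (Option A) => q.1.2 := Primrec.snd.comp Primrec.fst
    have hu : Primrec fun q : (α × ℤ) × Word (Option A) => q.2 := Primrec.snd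
    have hend : Primrec fun q : (α × ℤ) × Word (Option A) => q.1.2 + expSum q.2 :=
      primrec_add_expSum hk hu
    have he : Primrec fun q : ((α × ℤ) × Word (Option A)) × Edge A => q.2 := Primrec.snd
    refine PrimrecPred.forall_mem hK (PrimrecPred.forall_mem (hws.comp Primrec.fst)
      (PrimrecPred.imp (primrecRel_int_le.comp hend (hexp.comp ha))
      ((PrimrecPred.mem (hK.comp ha) hend).and (PrimrecPred.exists_mem (hT.comp ha) ?_))))
    exact (Primrec.eq.comp (src.comp he) (root (hk.comp Primrec.fst))).and <|
      (Primrec.eq.comp (tgt.comp he) (root (hend.comp Primrec.fst))).and <|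
      primrecPred_derives (hw.comp (ha.comp Primrec.fst)) (hD.comp (ha.comp Primrec.fst))
        (lab.comp he) (primrec_rewriteFrom (hk.comp Primrec.fst) (hu.comp Primrec.fst))
  · have ha : Primrec fun q : α × Edge A => q.1 := Primrec.fst
    have he : Primrec fun q : α × Edge A => q.2 := Primrec.snd
    exact PrimrecPred.exists_mem hT <|
      (Primrec.eq.comp (tgt.comp he) (Primrec.const _)).and <|
      (primrecPred_derives (hw.comp ha) (hD.comp ha) (Primrec.list_append.comp (lab.comp he)
        (primrec_rewriteFrom (Primrec.const 0) (hτ.comp ha))) (Primrec.const _)).and <|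
      (PrimrecPred.mem (hT.comp ha) (Primrec.pair (src.comp he) (Primrec.pair (Primrec.const [])
        (root (hexp.comp ha))))).not

/-- By Post's theorem it suffices to enumerate the predicate and its complement. Including the
primitive recursive validity test makes the predicate decidable on all inputs, and not just on those
satisfying the hypotheses. -/
theorem computablePred_isValid_and_mem : ComputablePred
    fun a : Word (Option A) × List (Word (Option A)) × Word (Option A) =>
      IsValid a.1 a.2.1 ∧ val a.1 a.2.2 ∈ submonoidOf a.1 a.2.1 := by
  rw [ComputablePred.computable_iff_re_compl_re']
  constructor
  · refine (rePred_exists (β := List (Word (Option A)) × List (Derivation A))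
      (R := fun a c => IsValid a.1 a.2.1 ∧ Confirms a.1 a.2.1 a.2.2 c.1 c.2) ?_).of_eq ?_
    · have ha : Primrec fun q : (Word (Option A) × List (Word (Option A)) × Word (Option A)) ×
          List (Word (Option A)) × List (Derivation A) => q.1 := Primrec.fst
      have h1 := Primrec.fst.comp ha
      have h2 := Primrec.fst.comp (Primrec.snd.comp ha)
      have h3 := Primrec.snd.comp (Primrec.snd.comp ha)
      exact (primrecPred_isValid.comp (Primrec.pair h1 h2)).and (primrecPred_confirms h1 h2 h3
        (Primrec.fst.comp Primrec.snd) (Primrec.snd.comp Primrec.snd))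
    · rintro ⟨w, ws, τ⟩
      constructor
      · rintro ⟨⟨L, D⟩, hv, hc⟩
        exact ⟨hv, (mem_iff_exists_confirms hv.1).2 ⟨L, D, hc⟩⟩
      · rintro ⟨hv, h⟩
        obtain ⟨L, D, hc⟩ := (mem_iff_exists_confirms hv.1).1 h
        exact ⟨(L, D), hv, hc⟩
  · refine (rePred_or_exists (P := fun a => ¬ IsValid a.1 a.2.1)
      (β := (A × ℤ × ℤ) × List (Derivation A) × List ℤ × List (Edge A))
      (R := fun a c => Refutes a.1 a.2.1 a.2.2 c.1.1 c.1.2.1 c.1.2.2 c.2.1 c.2.2.1 c.2.2.2)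
      ?_ ?_).of_eq ?_
    · exact (primrecPred_isValid.comp
        (Primrec.pair Primrec.fst (Primrec.fst.comp Primrec.snd))).not
    · exact primrecPred_refutes (Primrec.fst.comp Primrec.fst)
        (Primrec.fst.comp (Primrec.snd.comp Primrec.fst))
        (Primrec.snd.comp (Primrec.snd.comp Primrec.fst))
        (Primrec.fst.comp (Primrec.fst.comp Primrec.snd))
        (Primrec.fst.comp (Primrec.snd.comp (Primrec.fst.comp Primrec.snd)))
        (Primrec.snd.comp (Primrec.snd.comp (Primrec.fst.comp Primrec.snd)))
        (Primrec.fst.comp (Primrec.snd.comp Primrec.snd))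
        (Primrec.fst.comp (Primrec.snd.comp (Primrec.snd.comp Primrec.snd)))
        (Primrec.snd.comp (Primrec.snd.comp (Primrec.snd.comp Primrec.snd)))
    · rintro ⟨w, ws, τ⟩
      constructor
      · rintro (hv | ⟨c, hr⟩) ⟨hv', hm⟩
        · exact hv hv'
        · exact hr.not_mem hv'.1 hv'.2.2 hm
      · intro hn
        by_cases hv : IsValid w ws
        · obtain ⟨x, M, m, hp⟩ := (maxMinCondition_iff w).1 hv.2.1
          obtain ⟨D, K, T, hr⟩ := exists_refutes hp hv.1 hv.2.2 fun hm => hn ⟨hv, hm⟩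
          exact Or.inr ⟨((x, M, m), D, K, T), hr⟩
        · exact Or.inl hv

theorem computablePred_mem {w : Word (Option A)} {ws : List (Word (Option A))}
    (h : IsValid w ws) : ComputablePred fun τ => val w τ ∈ submonoidOf w ws := by
  obtain ⟨f, hf, e⟩ := ComputablePred.computable_iff.1 (computablePred_isValid_and_mem (A := A))
  refine ComputablePred.computable_iff.2 ⟨fun τ => f (w, ws, τ), hf.comp
    (Computable.pair (Computable.const w) (Computable.pair (Computable.const ws) Computable.id)), ?_⟩
  funext τ
  have := congrFun e (w, ws, τ)
  simpa [h] using this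

end Decidability

/-! ### Change of alphabet and the uniform algorithm. -/

section Relabelling

/-- The word obtained by applying a map to each letter. -/
def relabel {X Y : Type*} (φ : X → Y) (u : Word X) : Word Y := u.map fun p => (φ p.1, p.2)

theorem val_relabel_eq {X Y : Type*} (φ : X → Y) {r u v : Word X} (h : val r u = val r v) :
    val (relabel φ r) (relabel φ u) = val (relabel φ r) (relabel φ v) := by
  have hφ : ∀ v : Word X, lift (fun x => PresentedGroup.of (rels := {mk (relabel φ r)}) (φ x))
      (mk v) = val (relabel φ r) (relabel φ v) := by
    have e : lift (fun x => PresentedGroup.of (rels := {mk (relabel φ r)}) (φ x)) =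
        (PresentedGroup.mk {mk (relabel φ r)}).comp (FreeGroup.map φ) :=
      FreeGroup.ext_hom _ _ fun x => by simp [PresentedGroup.of]
    exact fun v => DFunLike.congr_fun e (mk v)
  have hr : ∀ s ∈ ({mk r} : Set (FreeGroup X)),
      lift (fun x => PresentedGroup.of (rels := {mk (relabel φ r)}) (φ x)) s = 1 := by
    rintro _ rfl
    rw [hφ]
    exact PresentedGroup.one_of_mem (Set.mem_singleton _)
  have key : ∀ v, PresentedGroup.toGroup hr (val r v) = val (relabel φ r) (relabel φ v) := hφ
  rw [← key, ← key, h]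

theorem mem_submonoidOf_relabel {X Y : Type*} (φ : X → Y) {r u : Word X} {us : List (Word X)}
    (h : val r u ∈ submonoidOf r us) :
    val (relabel φ r) (relabel φ u) ∈ submonoidOf (relabel φ r) (us.map (relabel φ)) := by
  obtain ⟨L, hL, e⟩ := mem_submonoidOf_iff.1 h
  refine mem_submonoidOf_iff.2 ⟨L.map (relabel φ), ?_, ?_⟩
  · intro v hv
    obtain ⟨v', hv', rfl⟩ := List.mem_map.1 hv
    exact List.mem_map_of_mem (hL v' hv')
  · rw [val_relabel_eq φ e]
    exact congrArg _ List.map_flatten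

/-- Relabelling preserves membership along any map of letters, so relabelling by `ψ` carries it
back. -/
theorem mem_submonoidOf_relabel_iff {X Y : Type*} {φ : X → Y} {ψ : Y → X}
    (hψ : Function.LeftInverse ψ φ) {r u : Word X} {us : List (Word X)} :
    val (relabel φ r) (relabel φ u) ∈ submonoidOf (relabel φ r) (us.map (relabel φ)) ↔
      val r u ∈ submonoidOf r us := by
  refine ⟨fun h => ?_, mem_submonoidOf_relabel φ⟩
  have hid : ∀ v : Word X, relabel ψ (relabel φ v) = v := fun v => by
    simp [relabel, Function.comp_def, hψ _]
  have h' := mem_submonoidOf_relabel ψ h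
  rw [List.map_map, show relabel ψ ∘ relabel φ = id from funext hid, List.map_id, hid u] at h'
  rwa [hid r] at h'

theorem expSum_relabel {A B : Type*} (j : A → B) (u : Word (Option A)) :
    expSum (relabel (Option.map j) u) = expSum u := by
  induction u with
  | nil => rfl
  | cons p u ih => obtain ⟨_ | _, _ | _⟩ := p <;> 
    simpa [expSum, relabel] using ih

theorem rewriteFrom_relabel {A B : Type*} (j : A → B) (k : ℤ) (u : Word (Option A)) :
    rewriteFrom k (relabel (Option.map j) u) =
      relabel (fun y => (j y.1, y.2)) (rewriteFrom k u) := by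
  induction u generalizing k with
  | nil => rfl
  | cons p u ih => obtain ⟨_ | _, _ | _⟩ := p <;> 
    simpa [rewriteFrom, relabel] using ih _

theorem MaxMinCondition.relabel_option {A B : Type*} [DecidableEq A] [DecidableEq B] {j : A → B}
    (hj : Function.Injective j) {w : Word (Option A)} (h : MaxMinCondition w) :
    MaxMinCondition (relabel (Option.map j) w) := by
  have hinj : Function.Injective fun y : A × ℤ => (j y.1, y.2) := by
    rintro ⟨a, i⟩ ⟨b, k⟩ h
    simpa [hj.eq_iff] using h
  have hocc : ∀ x i, occ (j x, i) (rewrite (relabel (Option.map j) w)) =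
      occ (x, i) (rewrite w) := fun x i => by
    rw [rewrite, rewriteFrom_relabel]
    exact occ_map hinj (x, i) _
  obtain ⟨x, M, m, h⟩ := h
  exact ⟨j x, M, m, by simpa only [hocc] using h⟩

theorem exists_computable_membership_test :
    ∃ f : ℕ × Word (Option ℕ) × List (Word (Option ℕ)) × Word (Option ℕ) → Bool, Computable f ∧
      ∀ (n : ℕ) (w : Word (Option (Fin n))) (ws : List (Word (Option (Fin n))))
        (τ : Word (Option (Fin n))), IsValid w ws →
        (f (n, code w, ws.map code, code τ) = true ↔ val w τ ∈ submonoidOf w ws) := by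
  obtain ⟨f, hf, e⟩ := ComputablePred.computable_iff.1 (computablePred_isValid_and_mem (A := ℕ))
  -- The alphabet size can be dropped: over `ℕ` the additional letters do not affect membership.
  refine ⟨fun a => f a.2, hf.comp Computable.snd, fun n w ws τ ⟨hw, hc, hws⟩ => ?_⟩
  have hv : IsValid (code w) (ws.map code) := by
    refine ⟨(expSum_relabel _ w).trans hw, hc.relabel_option Fin.val_injective, fun u hu => ?_⟩
    obtain ⟨v, hv, rfl⟩ := List.mem_map.1 hu
    exact (hws v hv).trans_eq (expSum_relabel _ v).symm
  -- The letter from the max-min condition provides the default value that `Function.invFun`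
  -- requires.
  have : Nonempty (Fin n) := ⟨hc.choose⟩
  have hinv : Function.LeftInverse (Option.map (Function.invFun (Fin.val : Fin n → ℕ)))
      (Option.map Fin.val) := fun o => by
    rw [Option.map_map, Function.invFun_comp Fin.val_injective, Option.map_id, id]
  rw [← mem_submonoidOf_relabel_iff hinv]
  have := congrFun e (code w, ws.map code, code τ)
  simp only [hv, true_and] at this
  exact Eq.to_iff this.symm

end Relabelling

/-! ### The infinite presentation of the group. -/

section Presentation

/-- When the exponent sum is `0`, the relator `w` and its rewrite take the same value wherever the
conjugation relations hold. This serves both directions of the isomorphism. -/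
theorem lift_map_some_mk_rewrite {A H : Type*} [Group H] (f : Option (A × ℤ) → H)
    (w : Word (Option A))
    (hf : ∀ a i, f (some (a, i)) = f none ^ i * f (some (a, 0)) * (f none ^ i)⁻¹) :
    lift f (FreeGroup.map some (mk (rewrite w))) =
      lift (fun o : Option A => o.elim (f none) fun a => f (some (a, 0))) (mk w) *
        (f none ^ expSum w)⁻¹ := by
  have e : (lift f).comp (FreeGroup.map some) =
      (lift (fun o : Option A => o.elim (f none) fun a => f (some (a, 0)))).comp (unrewrite A) :=
    FreeGroup.ext_hom _ _ fun ⟨a, i⟩ => by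
      simp only [MonoidHom.comp_apply, unrewrite, FreeGroup.map.of, lift_apply_of, map_mul, map_inv,
        map_zpow, Option.elim, hf a i]
  refine (DFunLike.congr_fun e (mk (rewrite w))).trans ?_
  rw [MonoidHom.comp_apply, rewrite, unrewrite_rewriteFrom]
  simp only [zpow_zero, one_mul, zero_add, map_mul, map_inv, map_zpow, lift_apply_of, Option.elim]

theorem exists_magnus_equiv {A : Type*} {w : Word (Option A)} (hw : expSum w = 0) :
    ∃ e : PresentedGroup (magnusRelators w) ≃* OneRelatorGroup w,
      e (PresentedGroup.of none) = PresentedGroup.of none ∧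
      ∀ (a : A) (i : ℤ), e (PresentedGroup.of (some (a, i))) =
        PresentedGroup.of none ^ i * PresentedGroup.of (some a) *
          (PresentedGroup.of none ^ i)⁻¹ := by
  let f : Option (A × ℤ) → OneRelatorGroup w := fun o => o.elim (PresentedGroup.of none) fun p =>
    PresentedGroup.of none ^ p.2 * PresentedGroup.of (some p.1) * (PresentedGroup.of none ^ p.2)⁻¹
  let g : Option A → PresentedGroup (magnusRelators w) := fun o =>
    o.elim (PresentedGroup.of none) fun a => PresentedGroup.of (some (a, 0))
  have hf : ∀ r ∈ magnusRelators w, lift f r = 1 := by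
    rintro _ (rfl | ⟨a, i, rfl⟩)
    · rw [lift_map_some_mk_rewrite f w (by simp [f]), hw]
      have : lift (fun o : Option A => o.elim (f none) fun a => f (some (a, 0))) =
          PresentedGroup.mk {mk w} := by
        refine FreeGroup.ext_hom _ _ fun o => ?_
        cases o <;> simp [f, PresentedGroup.of]
      rw [this, PresentedGroup.one_of_mem (Set.mem_singleton _)]
      simp
    · simp only [map_mul, map_inv, lift_apply_of, f, Option.elim]
      group
  have hstep : ∀ (a : A) (i : ℤ), (PresentedGroup.of (some (a, i + 1)) :
      PresentedGroup (magnusRelators w)) = PresentedGroup.of none * PresentedGroup.of (some (a, i)) *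
        (PresentedGroup.of none)⁻¹ := fun a i =>
    (mul_inv_eq_one.1 (PresentedGroup.one_of_mem (rels := magnusRelators w)
      (Or.inr ⟨a, i, rfl⟩))).symm
  have hconj : ∀ (a : A) (i : ℤ), (PresentedGroup.of (some (a, i)) :
      PresentedGroup (magnusRelators w)) = PresentedGroup.of none ^ i *
        PresentedGroup.of (some (a, 0)) * (PresentedGroup.of none ^ i)⁻¹ := by
    intro a i
    induction i using Int.induction_on with
    | zero => simp
    | succ i ih =>
      rw [hstep, ih]
      group
    | pred i ih =>
      -- For negative indices the relation `t a_j t⁻¹ = a_{j+1}` is solved for `a_j`.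
      have := hstep a (-i - 1)
      rw [sub_add_cancel, ih] at this
      have h : (PresentedGroup.of (some (a, -(i : ℤ) - 1)) : PresentedGroup (magnusRelators w)) =
          (PresentedGroup.of none)⁻¹ * (PresentedGroup.of none * PresentedGroup.of
            (some (a, -(i : ℤ) - 1)) * (PresentedGroup.of none)⁻¹) * PresentedGroup.of none := by
        group
      rw [h, ← this]
      group
  have hg : ∀ r ∈ ({mk w} : Set (FreeGroup (Option A))), lift g r = 1 := by
    rintro _ rfl
    have := lift_map_some_mk_rewrite (PresentedGroup.of (rels := magnusRelators w)) w hconj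
    have e : lift (PresentedGroup.of (rels := magnusRelators w)) = PresentedGroup.mk _ :=
      FreeGroup.ext_hom _ _ fun x => by simp [PresentedGroup.of]
    rw [e, PresentedGroup.one_of_mem (rels := magnusRelators w) (Or.inl rfl), hw] at this
    simpa using this.symm
  refine ⟨MonoidHom.toMulEquiv (PresentedGroup.toGroup hf) (PresentedGroup.toGroup hg) ?_ ?_,
    ?_, ?_⟩
  · refine PresentedGroup.ext fun o => ?_
    rcases o with _ | ⟨a, i⟩
    · simp [f, g]
    · simp [f, g, hconj a i]
  · refine PresentedGroup.ext fun o => ?_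
    cases o <;> simp [f, g]
  · simp [f]
  · intro a i
    simp [f]

end Presentation

end MagnusSubmonoid

/-- (1) The Magnus rewriting process gives a presentation of the group. (2) Membership in each
submonoid as described is decidable. (3) One algorithm, with the alphabet size, the relator, the
generating words and the test word as input, does this for all instances. -/
theorem mainTheorem1 :
    (∀ (A : Type*) [Finite A] (w : MagnusSubmonoid.Word (Option A)),
      MagnusSubmonoid.expSum w = 0 →
      ∃ e : PresentedGroup (MagnusSubmonoid.magnusRelators w) ≃*
          MagnusSubmonoid.OneRelatorGroup w,
        e (PresentedGroup.of none) = PresentedGroup.of none ∧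
        ∀ (a : A) (i : ℤ), e (PresentedGroup.of (some (a, i))) =
          PresentedGroup.of none ^ i * PresentedGroup.of (some a) *
            (PresentedGroup.of none ^ i)⁻¹) ∧
    (∀ (A : Type*) [Finite A] [DecidableEq A] [Primcodable A]
      (w : MagnusSubmonoid.Word (Option A)) (ws : List (MagnusSubmonoid.Word (Option A))),
      MagnusSubmonoid.expSum w = 0 →
      MagnusSubmonoid.MaxMinCondition w →
      (∀ u ∈ ws, 0 ≤ MagnusSubmonoid.expSum u) →
      ComputablePred fun τ : MagnusSubmonoid.Word (Option A) =>
        MagnusSubmonoid.val w τ ∈ MagnusSubmonoid.submonoidOf w ws) ∧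
    (∃ f : ℕ × MagnusSubmonoid.Word (Option ℕ) × List (MagnusSubmonoid.Word (Option ℕ)) ×
        MagnusSubmonoid.Word (Option ℕ) → Bool,
      Computable f ∧
      ∀ (n : ℕ) (w : MagnusSubmonoid.Word (Option (Fin n)))
        (ws : List (MagnusSubmonoid.Word (Option (Fin n))))
        (τ : MagnusSubmonoid.Word (Option (Fin n))),
        MagnusSubmonoid.expSum w = 0 →
        MagnusSubmonoid.MaxMinCondition w →
        (∀ u ∈ ws, 0 ≤ MagnusSubmonoid.expSum u) →
        (f (n, MagnusSubmonoid.code w, ws.map MagnusSubmonoid.code, MagnusSubmonoid.code τ) = true ↔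
          MagnusSubmonoid.val w τ ∈ MagnusSubmonoid.submonoidOf w ws)) :=
  ⟨fun _ _ _ hw => MagnusSubmonoid.exists_magnus_equiv hw,
    fun _ _ _ _ _ _ hw hc hws => MagnusSubmonoid.computablePred_mem ⟨hw, hc, hws⟩,
    by
      obtain ⟨f, hf, h⟩ := MagnusSubmonoid.exists_computable_membership_test
      exact ⟨f, hf, fun n w ws τ hw hc hws => h n w ws τ ⟨hw, hc, hws⟩⟩⟩
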